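/- Manifolds are finite-dimensional $C^\infty$ manifolds whose components may have different dimensions; they need not be Hausdorff or second countable unless this is said. Vector bundles are $C^\infty$, $\mathbb K$-linear with $\mathbb K=\mathbb R$ or $\mathbb C$, and of locally finite rank. Let $\Gamma\rightrightarrows X$ be a differentiable groupoid: $\Gamma$ and $X$ are manifolds, the source $s$ and the target $t$ are $C^\infty$ submersions, and composition, units and inversion are $C^\infty$. Assume that $\Gamma$ and $X$ are Hausdorff and second countable. A left Haar system $\mu=\{\mu_x\}_{x\in X}$ on $\Gamma$ consists of positive Radon measures $\mu_x$ on the target fibers $\Gamma_x=t^{-1}(x)$, positive on non-empty open sets, such that all $\mu_x$ are the measures associated to one $C^\infty$ positive density along the fibers of $t$, and such that $\mu_{t(g)}(gA)=\mu_{s(g)}(A)$ for all $g\in\Gamma$ and all Borel sets $A\subset\Gamma_{s(g)}$. A normalizing function for $\mu$ is a $C^\infty$ function $\kappa:X\to[0,\infty)$ such that $\operatorname{supp}(\kappa\circ s)\cap t^{-1}(K)$ is compact for every compact $K\subset X$ and $\int_{\Gamma_x}\kappa(s(h))\,d\mu_x(h)=1$ for every $x\in X$. Let $\nu=(\mu,\kappa)$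 be such a pair (a normalized left Haar system), and put $d\nu_x=(\kappa\circ s)\,d\mu_x$. Let $f:P\to X$ be a $C^\infty$ map from an arbitrary manifold $P$, let $E$ be a vector bundle over $P$, and let $k\in\{0,1,2,\dots,\infty\}$. Consider the manifold $P\times_{f,t}\Gamma=\{(y,h)\in P\times\Gamma : f(y)=t(h)\}$ with its projection $\mathrm{pr}_P$ to $P$. For a bundle $F$ over a manifold $M$ let $\Gamma^k(M;F)$ be the space of global $C^k$ sections, with the $C^k$-topology, i.e. the locally convex topology generated by the seminorms given by the suprema, over compact sets contained in the domain of a chart and of a local trivialization, of the derivatives of finite order at most $k$ of the local expressions of sections. Then for every $\vartheta\in\Gamma^k(P\times_{f,t}\Gamma;\mathrm{pr}_P^*E)$ and every $y\in P$ the function $h\mapsto\vartheta(y,h)\in E_y$ on $\Gamma_{f(y)}$ is $\nu_{f(y)}$-integrable, the formula $$\Bigl(\int\vartheta\,d\nu\Bigr)(y)=\int_{t(h)=f(y)}\vartheta(y,h)\,d\nu_{f(y)}(h)\in E_y$$ defines a global $C^k$ section $\int\vartheta\,d\nu$ of $E$, and the map $$\Gamma^k(P\times_{f,t}\Gamma;\mathrm{pr}_P^*E)\longrightarrow\Gamma^k(P;E),\qquad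 \vartheta\mapsto\int\vartheta\,d\nu,$$ is linear and continuous for the $C^k$-topologies. -/

import Mathlib

open scoped ContDiff Topology
open MeasureTheory

noncomputable section

universe u v w

/-! ### Differentiable manifolds

Manifolds are `C^∞` and finite dimensional; different charts may take values in Euclidean spaces of
different dimensions, and neither the Hausdorff property nor second countability is required. -/

/-- A `C^∞` atlas on `M` with charts in the spaces `ℝⁿ`, where `n` may depend on the chart. -/
class DiffManifold (M : Type u) [TopologicalSpace M] where
  atlas : Set (Σ n : ℕ, OpenPartialHomeomorph M (Fin n → ℝ))
  exists_chart : ∀ x : M, ∃ c ∈ atlas, x ∈ c.2.source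
  compatible : ∀ c ∈ atlas, ∀ d ∈ atlas,
    ContDiffOn ℝ ∞ (d.2 ∘ c.2.symm) (c.2.target ∩ c.2.symm ⁻¹' d.2.source)

section Manifold

variable {M : Type u} [TopologicalSpace M] [DiffManifold M]

/-- `φ` is a local `C^∞` coordinate chart of the manifold `M`, that is, it is compatible with every
chart of the given atlas. -/
def IsSmoothChart {F : Type*} [NormedAddCommGroup F] [NormedSpace ℝ F]
    (φ : OpenPartialHomeomorph M F) : Prop :=
  ∀ c ∈ DiffManifold.atlas (M := M),
    ContDiffOn ℝ ∞ (c.2 ∘ φ.symm) (φ.target ∩ φ.symm ⁻¹' c.2.source) ∧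
    ContDiffOn ℝ ∞ (φ ∘ c.2.symm) (c.2.target ∩ c.2.symm ⁻¹' φ.source)

/-- The function `g` with values in a normed space is of class `C^k` on the open set `U`. -/
def CkOn {F : Type*} [NormedAddCommGroup F] [NormedSpace ℝ F] (k : ℕ∞) (g : M → F)
    (U : Set M) : Prop :=
  ∀ ⦃n : ℕ⦄ (φ : OpenPartialHomeomorph M (Fin n → ℝ)), IsSmoothChart φ →
    ContDiffOn ℝ k (g ∘ φ.symm) (φ.target ∩ φ.symm ⁻¹' U)

theorem isSmoothChart_of_mem_atlas {c : Σ n : ℕ, OpenPartialHomeomorph M (Fin n → ℝ)}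
    (hc : c ∈ DiffManifold.atlas (M := M)) : IsSmoothChart c.2 :=
  fun d hd => ⟨DiffManifold.compatible c hc d hd, DiffManifold.compatible d hd c hc⟩

theorem IsSmoothChart.transition {F F' : Type*} [NormedAddCommGroup F] [NormedSpace ℝ F]
    [NormedAddCommGroup F'] [NormedSpace ℝ F'] {φ : OpenPartialHomeomorph M F}
    {ψ : OpenPartialHomeomorph M F'} (hφ : IsSmoothChart φ) (hψ : IsSmoothChart ψ) :
    ContDiffOn ℝ ∞ (ψ ∘ φ.symm) (φ.target ∩ φ.symm ⁻¹' ψ.source) := by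
  rintro a ⟨ha, ha'⟩
  obtain ⟨c, hc, hx⟩ := DiffManifold.exists_chart (φ.symm a)
  have h1 := (hφ c hc).1
  have h2 := (hψ c hc).2
  have o1 : IsOpen (φ.target ∩ φ.symm ⁻¹' c.2.source) :=
    φ.symm.isOpen_inter_preimage c.2.open_source
  have o2 : IsOpen (c.2.target ∩ c.2.symm ⁻¹' ψ.source) :=
    c.2.symm.isOpen_inter_preimage ψ.open_source
  have a1 : ContDiffAt ℝ ∞ (c.2 ∘ φ.symm) a := h1.contDiffAt (o1.mem_nhds ⟨ha, hx⟩)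
  have a2 : ContDiffAt ℝ ∞ (ψ ∘ c.2.symm) ((c.2 ∘ φ.symm) a) := by
    refine h2.contDiffAt (o2.mem_nhds ⟨c.2.map_source hx, ?_⟩)
    simpa [c.2.left_inv hx] using ha'
  refine ((a2.comp a a1).congr_of_eventuallyEq ?_).contDiffWithinAt
  filter_upwards [o1.mem_nhds ⟨ha, hx⟩] with b hb
  simp [c.2.left_inv hb.2]

end Manifold

/-- A differentiable (that is, `C^∞`) mapping between differentiable manifolds. -/
structure DiffMap (M : Type u) (N : Type v) [TopologicalSpace M] [TopologicalSpace N]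
    [DiffManifold M] [DiffManifold N] where
  toFun : M → N
  continuous_toFun : Continuous toFun
  smooth_toFun : ∀ ⦃m n : ℕ⦄ (φ : OpenPartialHomeomorph M (Fin m → ℝ))
    (ψ : OpenPartialHomeomorph N (Fin n → ℝ)), IsSmoothChart φ → IsSmoothChart ψ →
    ContDiffOn ℝ ∞ (ψ ∘ toFun ∘ φ.symm) (φ.target ∩ φ.symm ⁻¹' (toFun ⁻¹' ψ.source))

instance {M : Type u} {N : Type v} [TopologicalSpace M] [TopologicalSpace N]
    [DiffManifold M] [DiffManifold N] : CoeFun (DiffMap M N) (fun _ => M → N) :=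
  ⟨DiffMap.toFun⟩

/-- A pair of charts of `Z` and `Y` in which `f : Z → Y` becomes the projection
`ℝᵐ × ℝⁿ → ℝⁿ`. -/
structure SubmersionChart {Z : Type u} {Y : Type v} [TopologicalSpace Z] [TopologicalSpace Y]
    [DiffManifold Z] [DiffManifold Y] (f : Z → Y) (m n : ℕ) where
  chart : OpenPartialHomeomorph Z ((Fin m → ℝ) × (Fin n → ℝ))
  baseChart : OpenPartialHomeomorph Y (Fin n → ℝ)
  isSmoothChart : IsSmoothChart chart
  isSmoothChart_base : IsSmoothChart baseChart
  mapsTo : ∀ z ∈ chart.source, f z ∈ baseChart.source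
  eq_proj : ∀ z ∈ chart.source, (chart z).2 = baseChart (f z)

/-- A submersive differentiable mapping: near each point of its domain it is, in suitable charts, a
linear projection. -/
structure Submersion (Z : Type u) (Y : Type v) [TopologicalSpace Z] [TopologicalSpace Y]
    [DiffManifold Z] [DiffManifold Y] extends DiffMap Z Y where
  exists_submersionChart : ∀ z : Z, ∃ (m n : ℕ) (σ : SubmersionChart toFun m n),
    z ∈ σ.chart.source

instance {Z : Type u} {Y : Type v} [TopologicalSpace Z] [TopologicalSpace Y]
    [DiffManifold Z] [DiffManifold Y] : CoeFun (Submersion Z Y) (fun _ => Z → Y) :=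
  ⟨fun f => f.toDiffMap.toFun⟩

/-! ### The fiber product of a differentiable mapping and a submersion -/

section FiberProduct

variable {P : Type u} {Z : Type v} {Y : Type w} [TopologicalSpace P] [TopologicalSpace Z]
  [TopologicalSpace Y] [DiffManifold P] [DiffManifold Z] [DiffManifold Y]

/-- The fiber product `{(y, h) ∈ P × Z | f y = t h}`, with the topology induced from `P × Z`. -/
def FiberProd (f : DiffMap P Y) (t : Submersion Z Y) : Type (max u v) :=
  {q : P × Z // f q.1 = t q.2}

namespace FiberProd

variable {f : DiffMap P Y} {t : Submersion Z Y}

instance : TopologicalSpace (FiberProd f t) :=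
  inferInstanceAs (TopologicalSpace {q : P × Z // f q.1 = t q.2})

def fst (q : FiberProd f t) : P := q.1.1

def snd (q : FiberProd f t) : Z := q.1.2

def mk (y : P) (h : Z) (e : f y = t h) : FiberProd f t := ⟨(y, h), e⟩

theorem continuous_fst : Continuous (fst : FiberProd f t → P) :=
  _root_.continuous_fst.comp continuous_subtype_val

theorem continuous_snd : Continuous (snd : FiberProd f t → Z) :=
  _root_.continuous_snd.comp continuous_subtype_val

theorem fst_snd_eq (q : FiberProd f t) : f q.fst = t q.snd := q.2

variable {p m n : ℕ}

/-- The set of coordinates of points of the fiber product in the chart `fiberChart` below. -/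
def chartTarget (χ : OpenPartialHomeomorph P (Fin p → ℝ)) (σ : SubmersionChart t m n)
    (f : DiffMap P Y) : Set ((Fin p → ℝ) × (Fin m → ℝ)) :=
  {a | (a.1 ∈ χ.target ∧ f (χ.symm a.1) ∈ σ.baseChart.source) ∧
    (a.2, σ.baseChart (f (χ.symm a.1))) ∈ σ.chart.target}

theorem chartTarget_isOpen (χ : OpenPartialHomeomorph P (Fin p → ℝ))
    (σ : SubmersionChart t m n) (f : DiffMap P Y) : IsOpen (chartTarget χ σ f) := by
  have o1 : IsOpen (χ.target ∩ χ.symm ⁻¹' (f ⁻¹' σ.baseChart.source)) :=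
    χ.symm.isOpen_inter_preimage (σ.baseChart.open_source.preimage f.continuous_toFun)
  have o2 : IsOpen {a : (Fin p → ℝ) × (Fin m → ℝ) |
      a.1 ∈ χ.target ∩ χ.symm ⁻¹' (f ⁻¹' σ.baseChart.source)} :=
    o1.preimage _root_.continuous_fst
  have c : ContinuousOn (fun a : (Fin p → ℝ) × (Fin m → ℝ) =>
      (a.2, σ.baseChart (f (χ.symm a.1)))) {a : (Fin p → ℝ) × (Fin m → ℝ) |
      a.1 ∈ χ.target ∩ χ.symm ⁻¹' (f ⁻¹' σ.baseChart.source)} := by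
    refine _root_.continuous_snd.continuousOn.prodMk ?_
    refine σ.baseChart.continuousOn.comp (f.continuous_toFun.comp_continuousOn
      (χ.symm.continuousOn.comp _root_.continuous_fst.continuousOn ?_)) ?_
    · exact fun a ha => ha.1
    · exact fun a ha => ha.2
  exact c.isOpen_inter_preimage o2 σ.chart.open_target

theorem chartTarget_eq {χ : OpenPartialHomeomorph P (Fin p → ℝ)} {σ : SubmersionChart t m n}
    {f : DiffMap P Y} {a : (Fin p → ℝ) × (Fin m → ℝ)} (ha : a ∈ chartTarget χ σ f) :
    f (χ.symm a.1) = t (σ.chart.symm (a.2, σ.baseChart (f (χ.symm a.1)))) := by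
  have hz := σ.chart.map_target ha.2
  refine σ.baseChart.injOn ha.1.2 (σ.mapsTo _ hz) ?_
  rw [← σ.eq_proj _ hz, σ.chart.right_inv ha.2]

open Classical in
/-- The point with given coordinates in the chart `fiberChart` below; the point `q₀` is only used as
a default value. -/
def chartInv (χ : OpenPartialHomeomorph P (Fin p → ℝ)) (σ : SubmersionChart t m n)
    (q₀ : FiberProd f t) (a : (Fin p → ℝ) × (Fin m → ℝ)) : FiberProd f t :=
  if ha : a ∈ chartTarget χ σ f then
    mk (χ.symm a.1) (σ.chart.symm (a.2, σ.baseChart (f (χ.symm a.1)))) (chartTarget_eq ha)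
  else q₀

theorem chartInv_fst {χ : OpenPartialHomeomorph P (Fin p → ℝ)} {σ : SubmersionChart t m n}
    {q₀ : FiberProd f t} {a : (Fin p → ℝ) × (Fin m → ℝ)} (ha : a ∈ chartTarget χ σ f) :
    (chartInv χ σ q₀ a).fst = χ.symm a.1 := by
  rw [chartInv, dif_pos ha]; rfl

theorem chartInv_snd {χ : OpenPartialHomeomorph P (Fin p → ℝ)} {σ : SubmersionChart t m n}
    {q₀ : FiberProd f t} {a : (Fin p → ℝ) × (Fin m → ℝ)} (ha : a ∈ chartTarget χ σ f) :
    (chartInv χ σ q₀ a).snd = σ.chart.symm (a.2, σ.baseChart (f (χ.symm a.1))) := by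
  rw [chartInv, dif_pos ha]; rfl

theorem ext {q q' : FiberProd f t} (h : q.fst = q'.fst) (h' : q.snd = q'.snd) : q = q' :=
  Subtype.ext (Prod.ext h h')

/-- The chart `(y, h) ↦ (χ y, pr₁ (σ h))` of the fiber product. -/
def fiberChart (χ : OpenPartialHomeomorph P (Fin p → ℝ)) (σ : SubmersionChart t m n)
    (q₀ : FiberProd f t) :
    OpenPartialHomeomorph (FiberProd f t) ((Fin p → ℝ) × (Fin m → ℝ)) where
  toFun q := (χ q.fst, (σ.chart q.snd).1)
  invFun := chartInv χ σ q₀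
  source := {q | q.fst ∈ χ.source ∧ q.snd ∈ σ.chart.source}
  target := chartTarget χ σ f
  map_source' := by
    rintro q ⟨h1, h2⟩
    have e : σ.baseChart (f q.fst) = (σ.chart q.snd).2 := by
      rw [σ.eq_proj _ h2, fst_snd_eq]
    refine ⟨⟨χ.map_source h1, ?_⟩, ?_⟩
    · simp only [χ.left_inv h1, fst_snd_eq]
      exact σ.mapsTo _ h2
    · simp only [χ.left_inv h1, e]
      exact σ.chart.map_source h2
  map_target' := by
    intro a ha
    refine ⟨?_, ?_⟩
    · rw [chartInv_fst ha]; exact χ.map_target ha.1.1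
    · rw [chartInv_snd ha]; exact σ.chart.map_target ha.2
  left_inv' := by
    rintro q ⟨h1, h2⟩
    have e : σ.baseChart (f q.fst) = (σ.chart q.snd).2 := by
      rw [σ.eq_proj _ h2, fst_snd_eq]
    have ha : (χ q.fst, (σ.chart q.snd).1) ∈ chartTarget χ σ f := by
      refine ⟨⟨χ.map_source h1, ?_⟩, ?_⟩
      · simp only [χ.left_inv h1, fst_snd_eq]
        exact σ.mapsTo _ h2
      · simp only [χ.left_inv h1, e]
        exact σ.chart.map_source h2
    refine ext ?_ ?_
    · rw [chartInv_fst ha, χ.left_inv h1]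
    · rw [chartInv_snd ha, χ.left_inv h1, e]
      exact σ.chart.left_inv h2
  right_inv' := by
    intro a ha
    simp only [chartInv_fst ha, chartInv_snd ha]
    rw [χ.right_inv ha.1.1, σ.chart.right_inv ha.2]
  open_source := (χ.open_source.preimage continuous_fst).inter
    (σ.chart.open_source.preimage continuous_snd)
  open_target := chartTarget_isOpen χ σ f
  continuousOn_toFun := by
    refine (χ.continuousOn.comp continuous_fst.continuousOn fun q hq => hq.1).prodMk
      (_root_.continuous_fst.comp_continuousOn
        (σ.chart.continuousOn.comp continuous_snd.continuousOn fun q hq => hq.2))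
  continuousOn_invFun := by
    have key : ContinuousOn (fun a => (⟨(chartInv χ σ q₀ a).fst, (chartInv χ σ q₀ a).snd⟩ : P × Z))
        (chartTarget χ σ f) := by
      have c1 : ContinuousOn (fun a : (Fin p → ℝ) × (Fin m → ℝ) => χ.symm a.1)
          (chartTarget χ σ f) :=
        χ.symm.continuousOn.comp _root_.continuous_fst.continuousOn fun a ha => ha.1.1
      have c2 : ContinuousOn (fun a : (Fin p → ℝ) × (Fin m → ℝ) =>
          σ.chart.symm (a.2, σ.baseChart (f (χ.symm a.1)))) (chartTarget χ σ f) :=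
        σ.chart.symm.continuousOn.comp (_root_.continuous_snd.continuousOn.prodMk
          (σ.baseChart.continuousOn.comp (f.continuous_toFun.comp_continuousOn c1)
            fun a ha => ha.1.2)) fun a ha => ha.2
      refine (c1.prodMk c2).congr fun a ha => ?_
      exact Prod.ext (chartInv_fst ha) (chartInv_snd ha)
    exact Topology.IsInducing.subtypeVal.continuousOn_iff.2 key

/-- A linear isomorphism `ℝᵖ × ℝᵐ ≃ ℝᵖ⁺ᵐ`. -/
def prodEquiv (p m : ℕ) : ((Fin p → ℝ) × (Fin m → ℝ)) ≃L[ℝ] (Fin (p + m) → ℝ) :=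
  (LinearEquiv.ofFinrankEq _ _ (by simp)).toContinuousLinearEquiv

/-- The charts of the fiber product. -/
def charts (f : DiffMap P Y) (t : Submersion Z Y) :
    Set (Σ n : ℕ, OpenPartialHomeomorph (FiberProd f t) (Fin n → ℝ)) :=
  {c | ∃ (p m n : ℕ) (χ : OpenPartialHomeomorph P (Fin p → ℝ)) (σ : SubmersionChart t m n)
    (q₀ : FiberProd f t), IsSmoothChart χ ∧
      c = ⟨p + m, (fiberChart χ σ q₀).transHomeomorph (prodEquiv p m).toHomeomorph⟩}

theorem contDiffOn_chart_change {p m n p' m' n' : ℕ} {χ : OpenPartialHomeomorph P (Fin p → ℝ)}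
    {σ : SubmersionChart t m n} {χ' : OpenPartialHomeomorph P (Fin p' → ℝ)}
    {σ' : SubmersionChart t m' n'} (hχ : IsSmoothChart χ) (hχ' : IsSmoothChart χ')
    (q₀ q₀' : FiberProd f t) :
    ContDiffOn ℝ ∞ (fiberChart χ' σ' q₀' ∘ (fiberChart χ σ q₀).symm)
      ((fiberChart χ σ q₀).target ∩
        (fiberChart χ σ q₀).symm ⁻¹' (fiberChart χ' σ' q₀').source) := by
  have key : ContDiffOn ℝ ∞ (fun a : (Fin p → ℝ) × (Fin m → ℝ) =>
      (((χ' ∘ χ.symm) a.1, ((σ'.chart ∘ σ.chart.symm)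
        (a.2, (σ.baseChart ∘ f ∘ χ.symm) a.1)).1) : (Fin p' → ℝ) × (Fin m' → ℝ)))
      ((fiberChart χ σ q₀).target ∩
        (fiberChart χ σ q₀).symm ⁻¹' (fiberChart χ' σ' q₀').source) := by
    refine ContDiffOn.prodMk ?_ (contDiff_fst.comp_contDiffOn ?_)
    · refine (hχ.transition hχ').comp contDiff_fst.contDiffOn ?_
      rintro a ⟨ha, hb⟩
      have ha' : a ∈ chartTarget χ σ f := ha
      refine ⟨ha'.1.1, ?_⟩
      have := hb.1
      change (chartInv χ σ q₀ a).fst ∈ χ'.source at this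
      rwa [chartInv_fst ha'] at this
    · refine (σ.isSmoothChart.transition σ'.isSmoothChart).comp (contDiff_snd.contDiffOn.prodMk
        ((f.smooth_toFun χ σ.baseChart hχ σ.isSmoothChart_base).comp contDiff_fst.contDiffOn ?_)) ?_
      · rintro a ⟨ha, hb⟩
        have ha' : a ∈ chartTarget χ σ f := ha
        exact ha'.1
      · rintro a ⟨ha, hb⟩
        have ha' : a ∈ chartTarget χ σ f := ha
        refine ⟨ha'.2, ?_⟩
        have := hb.2
        change (chartInv χ σ q₀ a).snd ∈ σ'.chart.source at this
        rwa [chartInv_snd ha'] at this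
  refine key.congr ?_
  rintro a ⟨ha, hb⟩
  have ha' : a ∈ chartTarget χ σ f := ha
  change (χ' (chartInv χ σ q₀ a).fst, (σ'.chart (chartInv χ σ q₀ a).snd).1) = _
  rw [chartInv_fst ha', chartInv_snd ha']
  rfl

/-- The fiber product as a differentiable manifold, a submanifold of `P × Z`. -/
instance : DiffManifold (FiberProd f t) where
  atlas := charts f t
  exists_chart := by
    intro q
    obtain ⟨c, hc, hq⟩ := DiffManifold.exists_chart q.fst
    obtain ⟨m, n, σ, hσ⟩ := t.exists_submersionChart q.snd
    exact ⟨_, ⟨c.1, m, n, c.2, σ, q, isSmoothChart_of_mem_atlas hc, rfl⟩, hq, hσ⟩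
  compatible := by
    rintro _ ⟨p, m, n, χ, σ, q, hχ, rfl⟩ _ ⟨p', m', n', χ', σ', q', hχ', rfl⟩
    have h := contDiffOn_chart_change (σ := σ) (σ' := σ') hχ hχ' q q'
    exact (prodEquiv p' m').contDiff.comp_contDiffOn
      (h.comp (prodEquiv p m).symm.contDiff.contDiffOn fun a ha => ha)

theorem isSmoothChart_fiberChart {χ : OpenPartialHomeomorph P (Fin p → ℝ)} (hχ : IsSmoothChart χ)
    (σ : SubmersionChart t m n) (q₀ : FiberProd f t) :
    IsSmoothChart (fiberChart χ σ q₀) := by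
  rintro _ ⟨p', m', n', χ', σ', q', hχ', rfl⟩
  refine ⟨(prodEquiv p' m').contDiff.comp_contDiffOn
    (contDiffOn_chart_change (σ := σ) (σ' := σ') hχ hχ' q₀ q'), ?_⟩
  exact (contDiffOn_chart_change (σ := σ') (σ' := σ) hχ' hχ q' q₀).comp
    (prodEquiv p' m').symm.contDiff.contDiffOn fun a ha => ha

/-- The projection of the fiber product on the first factor, as a differentiable mapping. -/
def proj (f : DiffMap P Y) (t : Submersion Z Y) : DiffMap (FiberProd f t) P where
  toFun := fst
  continuous_toFun := continuous_fst
  smooth_toFun := by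
    rintro k l e ψ he hψ a ⟨ha, hb⟩
    obtain ⟨c, hc, hq⟩ := DiffManifold.exists_chart (e.symm a).fst
    obtain ⟨m, n, σ, hσ⟩ := t.exists_submersionChart (e.symm a).snd
    have hχ := isSmoothChart_of_mem_atlas hc
    set F := fiberChart c.2 σ (e.symm a) with hF
    have hs : e.symm a ∈ F.source := ⟨hq, hσ⟩
    have h1 := he.transition (isSmoothChart_fiberChart (f := f) hχ σ (e.symm a))
    have o1 : IsOpen (e.target ∩ e.symm ⁻¹' F.source) := e.symm.isOpen_inter_preimage F.open_source
    have a1 : ContDiffAt ℝ ∞ (F ∘ e.symm) a := h1.contDiffAt (o1.mem_nhds ⟨ha, hs⟩)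
    have o2 : IsOpen (c.2.target ∩ c.2.symm ⁻¹' ψ.source) :=
      c.2.symm.isOpen_inter_preimage ψ.open_source
    have a2 : ContDiffAt ℝ ∞ (ψ ∘ c.2.symm) (Prod.fst ((F ∘ e.symm) a)) := by
      refine (hχ.transition hψ).contDiffAt (o2.mem_nhds ⟨c.2.map_source hq, ?_⟩)
      change c.2.symm (c.2 (e.symm a).fst) ∈ ψ.source
      rw [c.2.left_inv hq]
      exact hb
    have a3 : ContDiffAt ℝ ∞ (fun b => (ψ ∘ c.2.symm) (Prod.fst ((F ∘ e.symm) b))) a :=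
      ContDiffAt.comp (g := ψ ∘ c.2.symm) (f := fun b => Prod.fst ((F ∘ e.symm) b)) a a2
        (contDiffAt_fst.comp a a1)
    refine (a3.congr_of_eventuallyEq ?_).contDiffWithinAt
    filter_upwards [o1.mem_nhds ⟨ha, hs⟩] with b hb'
    change ψ (e.symm b).fst = ψ (c.2.symm (c.2 (e.symm b).fst))
    rw [c.2.left_inv hb'.2.1]

end FiberProd

end FiberProduct

/-! ### Differentiable vector bundles -/

/-- A local trivialization of a family of `𝕂`-vector spaces over an open subset of `M`. The linear
maps `coord x` are irrelevant for `x` outside `baseSet`. -/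
structure LocalTriv (𝕂 : Type) [RCLike 𝕂] {M : Type u} [TopologicalSpace M] (E : M → Type w)
    [∀ x, AddCommGroup (E x)] [∀ x, Module 𝕂 (E x)] where
  baseSet : Set M
  isOpen_baseSet : IsOpen baseSet
  rank : ℕ
  coord : ∀ x, E x →ₗ[𝕂] (Fin rank → 𝕂)
  bijective_coord : ∀ x ∈ baseSet, Function.Bijective (coord x)

/-- The passage from `τ` to `τ'` over the intersection of their domains is given by multiplication
by a matrix whose entries are functions of class `C^∞`. -/
def LocalTriv.SmoothTransition {𝕂 : Type} [RCLike 𝕂] {M : Type u} [TopologicalSpace M]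
    [DiffManifold M] {E : M → Type w} [∀ x, AddCommGroup (E x)] [∀ x, Module 𝕂 (E x)]
    (τ τ' : LocalTriv 𝕂 E) : Prop :=
  ∃ A : M → Matrix (Fin τ'.rank) (Fin τ.rank) 𝕂,
    (∀ i j, CkOn (⊤ : ℕ∞) (fun x => A x i j) (τ.baseSet ∩ τ'.baseSet)) ∧
    ∀ x ∈ τ.baseSet ∩ τ'.baseSet, ∀ e : E x, τ'.coord x e = (A x).mulVec (τ.coord x e)

/-- A `𝕂`-linear differentiable vector bundle over `M`, with fibers `E x`, given by an atlas of local
trivializations. The rank is finite but may vary from a component of `M` to another. -/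
class DiffVectorBundle (𝕂 : Type) [RCLike 𝕂] {M : Type u} [TopologicalSpace M] [DiffManifold M]
    (E : M → Type w) [∀ x, AddCommGroup (E x)] [∀ x, Module 𝕂 (E x)] where
  atlas : Set (LocalTriv 𝕂 E)
  exists_triv : ∀ x : M, ∃ τ ∈ atlas, x ∈ τ.baseSet
  compatible : ∀ τ ∈ atlas, ∀ τ' ∈ atlas, τ.SmoothTransition τ'

section Bundle

variable {𝕂 : Type} [RCLike 𝕂] {M : Type u} [TopologicalSpace M] [DiffManifold M]
  {E : M → Type w} [∀ x, AddCommGroup (E x)] [∀ x, Module 𝕂 (E x)] [DiffVectorBundle 𝕂 E]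

/-- `τ` is a `C^∞` local trivialization of the vector bundle `E`. -/
def LocalTriv.IsSmooth (τ : LocalTriv 𝕂 E) : Prop :=
  ∀ σ ∈ DiffVectorBundle.atlas (𝕂 := 𝕂) (E := E), τ.SmoothTransition σ ∧ σ.SmoothTransition τ

variable (𝕂 E) in
theorem DiffVectorBundle.finiteDimensional (x : M) : FiniteDimensional 𝕂 (E x) := by
  obtain ⟨τ, -, hx⟩ := DiffVectorBundle.exists_triv (𝕂 := 𝕂) (E := E) x
  exact FiniteDimensional.of_injective (τ.coord x) (τ.bijective_coord x hx).1

end Bundle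

section Pullback

theorem CkOn.comp_diffMap {M : Type u} {N : Type v} [TopologicalSpace M] [DiffManifold M]
    [TopologicalSpace N] [DiffManifold N] {F : Type*} [NormedAddCommGroup F] [NormedSpace ℝ F]
    {k : ℕ∞} {g : N → F} {U : Set N} (hU : IsOpen U) (hg : CkOn k g U) (f : DiffMap M N) :
    CkOn k (fun x => g (f x)) (f ⁻¹' U) := by
  rintro n φ hφ a ⟨ha, hb⟩
  obtain ⟨c, hc, hq⟩ := DiffManifold.exists_chart (f (φ.symm a))
  have hχ := isSmoothChart_of_mem_atlas hc
  have o1 : IsOpen (φ.target ∩ φ.symm ⁻¹' (f ⁻¹' c.2.source)) :=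
    φ.symm.isOpen_inter_preimage (c.2.open_source.preimage f.continuous_toFun)
  have o2 : IsOpen (c.2.target ∩ c.2.symm ⁻¹' U) := c.2.symm.isOpen_inter_preimage hU
  have a1 : ContDiffAt ℝ ∞ (c.2 ∘ f ∘ φ.symm) a :=
    (f.smooth_toFun φ c.2 hφ hχ).contDiffAt (o1.mem_nhds ⟨ha, hq⟩)
  have a2 : ContDiffAt ℝ k (g ∘ c.2.symm) ((c.2 ∘ f ∘ φ.symm) a) := by
    refine (hg c.2 hχ).contDiffAt (o2.mem_nhds ⟨c.2.map_source hq, ?_⟩)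
    change c.2.symm (c.2 (f (φ.symm a))) ∈ U
    rw [c.2.left_inv hq]
    exact hb
  refine ((a2.comp a (a1.of_le (by exact_mod_cast le_top))).congr_of_eventuallyEq
    ?_).contDiffWithinAt
  filter_upwards [o1.mem_nhds ⟨ha, hq⟩] with b hb'
  have := c.2.left_inv hb'.2
  simp only [Function.comp_apply] at this ⊢
  rw [this]

variable {𝕂 : Type} [RCLike 𝕂] {M : Type u} {N : Type v} [TopologicalSpace M] [TopologicalSpace N]
  [DiffManifold M] [DiffManifold N]

/-- The family of fibers `x ↦ E (f x)` of the pullback `f^*E`. -/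
def Pullback (f : DiffMap M N) (E : N → Type w) : M → Type w := fun x => E (f x)

variable (f : DiffMap M N) (E : N → Type w) [∀ x, AddCommGroup (E x)] [∀ x, Module 𝕂 (E x)]

instance (x : M) : AddCommGroup (Pullback f E x) := inferInstanceAs (AddCommGroup (E (f x)))

instance (x : M) : Module 𝕂 (Pullback f E x) := inferInstanceAs (Module 𝕂 (E (f x)))

variable {E} in
/-- The pullback of a local trivialization. -/
def LocalTriv.pullback (τ : LocalTriv 𝕂 E) : LocalTriv 𝕂 (Pullback f E) where
  baseSet := f ⁻¹' τ.baseSet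
  isOpen_baseSet := τ.isOpen_baseSet.preimage f.continuous_toFun
  rank := τ.rank
  coord x := τ.coord (f x)
  bijective_coord x hx := τ.bijective_coord (f x) hx

/-- The pullback vector bundle `f^*E`. -/
instance [DiffVectorBundle 𝕂 E] : DiffVectorBundle 𝕂 (Pullback f E) where
  atlas := LocalTriv.pullback f '' DiffVectorBundle.atlas
  exists_triv x := by
    obtain ⟨τ, h, hx⟩ := DiffVectorBundle.exists_triv (𝕂 := 𝕂) (E := E) (f x)
    exact ⟨_, ⟨τ, h, rfl⟩, hx⟩
  compatible := by
    rintro _ ⟨τ, h, rfl⟩ _ ⟨τ', h', rfl⟩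
    obtain ⟨A, hA, hA'⟩ := DiffVectorBundle.compatible τ h τ' h'
    exact ⟨fun x => A (f x),
      fun i j => (hA i j).comp_diffMap (τ.isOpen_baseSet.inter τ'.isOpen_baseSet) f,
      fun x hx e => hA' (f x) hx e⟩

end Pullback

/-! ### Spaces of sections and their `C^k`-topology -/

section Sections

variable (𝕂 : Type) [RCLike 𝕂] (k : ℕ∞) {M : Type u} [TopologicalSpace M] [DiffManifold M]
  (E : M → Type w) [∀ x, AddCommGroup (E x)] [∀ x, Module 𝕂 (E x)] [DiffVectorBundle 𝕂 E]

/-- The space of global sections of class `C^k`, as a subspace of the space of all sections: in every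
local trivialization the components are functions of class `C^k`. -/
def ckSections : Submodule 𝕂 (∀ x, E x) where
  carrier := {ξ | ∀ τ : LocalTriv 𝕂 E, τ.IsSmooth → CkOn k (fun x => τ.coord x (ξ x)) τ.baseSet}
  add_mem' := by
    intro ξ η hξ hη τ hτ n φ hφ
    refine ((hξ τ hτ φ hφ).add (hη τ hτ φ hφ)).congr fun a _ => ?_
    simp
  zero_mem' := by
    intro τ hτ n φ hφ
    refine (contDiffOn_const (c := (0 : Fin τ.rank → 𝕂))).congr fun a _ => ?_
    simp
  smul_mem' := by
    intro c ξ hξ τ hτ n φ hφ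
    refine ((hξ τ hτ φ hφ).const_smul c).congr fun a _ => ?_
    simp

/-- The vector space `Γ^k(M; E)` of global sections of class `C^k`. -/
def CkSection : Type (max u w) := ckSections 𝕂 k E

instance : AddCommGroup (CkSection 𝕂 k E) := inferInstanceAs (AddCommGroup (ckSections 𝕂 k E))

instance : Module 𝕂 (CkSection 𝕂 k E) := inferInstanceAs (Module 𝕂 (ckSections 𝕂 k E))

instance : CoeFun (CkSection 𝕂 k E) (fun _ => ∀ x, E x) := ⟨fun ξ => ξ.1⟩

/-- The data on which a generating seminorm of the `C^k`-topology depends: a local chart, a local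
trivialization, a compact set contained in the domains of both, and an order `r ≤ k`. -/
structure CkSeminormIndex where
  dim : ℕ
  chart : OpenPartialHomeomorph M (Fin dim → ℝ)
  isSmoothChart : IsSmoothChart chart
  triv : LocalTriv 𝕂 E
  isSmooth_triv : triv.IsSmooth
  K : Set M
  isCompact_K : IsCompact K
  K_subset_source : K ⊆ chart.source
  K_subset_baseSet : K ⊆ triv.baseSet
  r : ℕ
  r_le : (r : ℕ∞) ≤ k

variable {𝕂 k E}

namespace CkSeminormIndex

/-- The local expression, with values in `𝕂ᴺ`, of a section in the given chart and trivialization. -/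
def localExpr (i : CkSeminormIndex 𝕂 k E) (ξ : CkSection 𝕂 k E) :
    (Fin i.dim → ℝ) → (Fin i.triv.rank → 𝕂) :=
  fun a => i.triv.coord (i.chart.symm a) (ξ (i.chart.symm a))

theorem contDiffAt_localExpr (i : CkSeminormIndex 𝕂 k E) (ξ : CkSection 𝕂 k E) {x : M}
    (hx : x ∈ i.K) : ContDiffAt ℝ k (i.localExpr ξ) (i.chart x) := by
  have o : IsOpen (i.chart.target ∩ i.chart.symm ⁻¹' i.triv.baseSet) :=
    i.chart.symm.isOpen_inter_preimage i.triv.isOpen_baseSet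
  have hs := i.K_subset_source hx
  refine (ξ.2 i.triv i.isSmooth_triv i.chart i.isSmoothChart).contDiffAt
    (o.mem_nhds ⟨i.chart.map_source hs, ?_⟩)
  simpa [i.chart.left_inv hs] using i.K_subset_baseSet hx

theorem bddAbove_localExpr (i : CkSeminormIndex 𝕂 k E) {s : ℕ} (hs : s ≤ i.r)
    (ξ : CkSection 𝕂 k E) :
    BddAbove (Set.range fun x : i.K => ‖iteratedFDeriv ℝ s (i.localExpr ξ) (i.chart x)‖) := by
  have c : ContinuousOn (fun x => ‖iteratedFDeriv ℝ s (i.localExpr ξ) (i.chart x)‖) i.K := by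
    intro x hx
    have h1 : ContinuousAt (iteratedFDeriv ℝ s (i.localExpr ξ)) (i.chart x) :=
      (i.contDiffAt_localExpr ξ hx).continuousAt_iteratedFDeriv
        (by exact_mod_cast (Nat.cast_le.2 hs).trans i.r_le)
    exact (ContinuousAt.comp (f := i.chart) h1
      (i.chart.continuousAt (i.K_subset_source hx))).norm.continuousWithinAt
  have := (i.isCompact_K.bddAbove_image c)
  rwa [Set.image_eq_range] at this

/-- The seminorm `ξ ↦ sup_{x ∈ K} ‖D^s ξ^{τ,φ}(φ x)‖`, where `ξ^{τ,φ}` is the local expression. -/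
def derivSeminorm (i : CkSeminormIndex 𝕂 k E) (s : Fin (i.r + 1)) :
    Seminorm 𝕂 (CkSection 𝕂 k E) :=
  Seminorm.of (fun ξ => ⨆ x : i.K, ‖iteratedFDeriv ℝ s (i.localExpr ξ) (i.chart x)‖)
    (by
      intro ξ η
      have hs : (s : ℕ) ≤ i.r := Nat.lt_succ_iff.1 s.2
      refine Real.iSup_le (fun x => ?_) (add_nonneg (Real.iSup_nonneg fun x => norm_nonneg _)
        (Real.iSup_nonneg fun x => norm_nonneg _))
      have hk : ((s : ℕ) : WithTop ℕ∞) ≤ ((k : ℕ∞) : WithTop ℕ∞) := by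
        exact_mod_cast (Nat.cast_le.2 hs).trans i.r_le
      have e : i.localExpr (ξ + η) = i.localExpr ξ + i.localExpr η := by
        funext a
        exact map_add (i.triv.coord (i.chart.symm a)) _ _
      rw [e, iteratedFDeriv_add_apply ((i.contDiffAt_localExpr ξ x.2).of_le hk)
        ((i.contDiffAt_localExpr η x.2).of_le hk)]
      exact (norm_add_le _ _).trans (_root_.add_le_add (le_ciSup (i.bddAbove_localExpr hs ξ) x)
        (le_ciSup (i.bddAbove_localExpr hs η) x)))
    (by
      intro c ξ
      have hs : (s : ℕ) ≤ i.r := Nat.lt_succ_iff.1 s.2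
      have hk : ((s : ℕ) : WithTop ℕ∞) ≤ ((k : ℕ∞) : WithTop ℕ∞) := by
        exact_mod_cast (Nat.cast_le.2 hs).trans i.r_le
      have e : i.localExpr (c • ξ) = c • i.localExpr ξ := by
        funext a
        exact map_smul (i.triv.coord (i.chart.symm a)) _ _
      rw [Real.mul_iSup_of_nonneg (norm_nonneg c)]
      refine iSup_congr fun x => ?_
      rw [e, iteratedFDeriv_const_smul_apply ((i.contDiffAt_localExpr ξ x.2).of_le hk), norm_smul])

end CkSeminormIndex

variable (𝕂 k E) in
/-- The seminorms `ξ ↦ max_{s ≤ r} sup_{x ∈ K} ‖D^s ξ^{τ,φ}(φ x)‖`. -/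
def ckSeminormFamily : SeminormFamily 𝕂 (CkSection 𝕂 k E) (CkSeminormIndex 𝕂 k E) :=
  fun i => Finset.univ.sup i.derivSeminorm

/-- The `C^k`-topology: the locally convex topology generated by the seminorms above, for all choices
of charts, trivializations, compact sets and orders `r ≤ k`. -/
instance : TopologicalSpace (CkSection 𝕂 k E) :=
  (ckSeminormFamily 𝕂 k E).moduleFilterBasis.topology

end Sections

/-! ### Integration of functions with values in a finite dimensional vector space -/

section Integral

variable (𝕂 : Type) [RCLike 𝕂] {α : Type*} [MeasurableSpace α] {V : Type*} [AddCommGroup V]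
  [Module 𝕂 V]

/-- All components of the vector-valued function `g` are integrable. -/
def ComponentwiseIntegrable (g : α → V) (ν : Measure α) : Prop :=
  ∀ l : V →ₗ[𝕂] 𝕂, Integrable (fun a => l (g a)) ν

/-- The integral of a function with values in a finite dimensional vector space, computed by means of
the components with respect to a basis. -/
def vectorIntegral [FiniteDimensional 𝕂 V] (g : α → V) (ν : Measure α) : V :=
  ∑ j, (∫ a, (Module.finBasis 𝕂 V).coord j (g a) ∂ν) • Module.finBasis 𝕂 V j

/-- The integral does not depend on the choice of the basis. -/
theorem map_vectorIntegral [FiniteDimensional 𝕂 V] {g : α → V} {ν : Measure α}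
    (hg : ComponentwiseIntegrable 𝕂 g ν) (l : V →ₗ[𝕂] 𝕂) :
    l (vectorIntegral 𝕂 g ν) = ∫ a, l (g a) ∂ν := by
  have e : ∀ a, l (g a) = ∑ j, (Module.finBasis 𝕂 V).coord j (g a) * l (Module.finBasis 𝕂 V j) := by
    intro a
    conv_lhs => rw [← (Module.finBasis 𝕂 V).sum_repr (g a)]
    simp [map_sum, map_smul, -Module.Basis.sum_repr]
  simp only [e, vectorIntegral, map_sum, map_smul, smul_eq_mul]
  rw [integral_finsetSum _ fun j _ => (hg _).mul_const _]
  simp only [integral_mul_const]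

end Integral

/-! ### Differentiable groupoids and Haar systems -/

/-- A differentiable groupoid with arrow manifold `Γ` and base manifold `X`. Two arrows `g`, `h` can
be composed to an arrow `g h` when the source of `g` is the target of `h`. -/
structure DiffGroupoid (Γ : Type u) (X : Type v) [TopologicalSpace Γ] [TopologicalSpace X]
    [DiffManifold Γ] [DiffManifold X] where
  src : Submersion Γ X
  tgt : Submersion Γ X
  comp : DiffMap (FiberProd src.toDiffMap tgt) Γ
  one : DiffMap X Γ
  inv : DiffMap Γ Γ
  src_comp : ∀ q, src (comp q) = src q.snd
  tgt_comp : ∀ q, tgt (comp q) = tgt q.fst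
  src_one : ∀ x, src (one x) = x
  tgt_one : ∀ x, tgt (one x) = x
  src_inv : ∀ g, src (inv g) = tgt g
  tgt_inv : ∀ g, tgt (inv g) = src g
  one_comp : ∀ g, comp (.mk (one (tgt g)) g (src_one (tgt g))) = g
  comp_one : ∀ g, comp (.mk g (one (src g)) (tgt_one (src g)).symm) = g
  inv_comp : ∀ g, comp (.mk (inv g) g (src_inv g)) = one (src g)
  comp_inv : ∀ g, comp (.mk g (inv g) (tgt_inv g).symm) = one (tgt g)
  assoc : ∀ (a b c : Γ) (hab : src a = tgt b) (hbc : src b = tgt c),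
    comp (.mk (comp (.mk a b hab)) c ((src_comp _).trans hbc)) =
      comp (.mk a (comp (.mk b c hbc)) (hab.trans (tgt_comp (.mk b c hbc)).symm))

/-- The derivative at `z` of the change of vertical coordinates between two submersion charts, the
base coordinates being kept fixed. -/
def SubmersionChart.verticalDeriv {Z : Type u} {Y : Type v} [TopologicalSpace Z]
    [TopologicalSpace Y] [DiffManifold Z] [DiffManifold Y] {f : Z → Y} {m n n' : ℕ}
    (σ : SubmersionChart f m n) (σ' : SubmersionChart f m n') (z : Z) :
    (Fin m → ℝ) →L[ℝ] (Fin m → ℝ) :=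
  fderiv ℝ (fun v => (σ'.chart (σ.chart.symm (v, (σ.chart z).2))).1) (σ.chart z).1

/-- A volume density along the fibers of `f`. For each submersion chart `σ` with vertical coordinates
`v₁, …, vₘ`, the number `coeff σ z` is the value of the density on `∂/∂v₁ ∧ ⋯ ∧ ∂/∂vₘ` at `z`. -/
structure VerticalVolumeDensity {Z : Type u} {Y : Type v} [TopologicalSpace Z]
    [TopologicalSpace Y] [DiffManifold Z] [DiffManifold Y] (f : Z → Y) where
  coeff : ∀ {m n : ℕ}, SubmersionChart f m n → Z → ℝ
  smooth_coeff : ∀ {m n : ℕ} (σ : SubmersionChart f m n), CkOn (⊤ : ℕ∞) (coeff σ) σ.chart.source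
  coeff_pos : ∀ {m n : ℕ} (σ : SubmersionChart f m n), ∀ z ∈ σ.chart.source, 0 < coeff σ z
  coeff_change : ∀ {m n n' : ℕ} (σ : SubmersionChart f m n) (σ' : SubmersionChart f m n'),
    ∀ z ∈ σ.chart.source ∩ σ'.chart.source,
      coeff σ z = |(σ.verticalDeriv σ' z).det| * coeff σ' z

/-- `μ` is the measure on the fiber over `y` associated to the density `δ`: in the vertical
coordinates of any submersion chart it is the Lebesgue measure multiplied by the coefficient of the
density. -/
def VerticalVolumeDensity.IsFiberMeasure {Z : Type u} {Y : Type v} [TopologicalSpace Z]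
    [TopologicalSpace Y] [DiffManifold Z] [DiffManifold Y] [MeasurableSpace Z] {f : Z → Y}
    (δ : VerticalVolumeDensity f) (y : Y) (μ : Measure {z : Z // f z = y}) : Prop :=
  ∀ ⦃m n : ℕ⦄ (σ : SubmersionChart f m n) (A : Set {z : Z // f z = y}), MeasurableSet A →
    (∀ z ∈ A, z.1 ∈ σ.chart.source) →
    μ A = ∫⁻ v in (fun z : {z : Z // f z = y} => (σ.chart z.1).1) '' A,
      ENNReal.ofReal (δ.coeff σ (σ.chart.symm (v, σ.baseChart y)))

namespace DiffGroupoid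

variable {Γ : Type u} {X : Type v} [TopologicalSpace Γ] [TopologicalSpace X] [DiffManifold Γ]
  [DiffManifold X] (G : DiffGroupoid Γ X)

/-- The target fiber `t⁻¹(x)`. -/
abbrev TargetFiber (x : X) : Type u := {h : Γ // G.tgt h = x}

/-- Left translation `h ↦ g h` from the target fiber at the source of `g` to the target fiber at the
target of `g`. -/
def leftTranslate (g : Γ) (h : G.TargetFiber (G.src g)) : G.TargetFiber (G.tgt g) :=
  ⟨G.comp (.mk g h.1 h.2.symm), G.tgt_comp _⟩

/-- A left Haar system: a family of positive Radon measures on the target fibers. -/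
structure LeftHaarSystem [MeasurableSpace Γ] where
  measure : ∀ x : X, Measure (G.TargetFiber x)
  regular : ∀ x, (measure x).Regular
  differentiable : ∃ δ : VerticalVolumeDensity G.tgt, ∀ x, δ.IsFiberMeasure x (measure x)
  left_invariant : ∀ (g : Γ) (A : Set (G.TargetFiber (G.src g))), MeasurableSet A →
    measure (G.tgt g) (G.leftTranslate g '' A) = measure (G.src g) A
  definite : ∀ (x : X) (U : Set (G.TargetFiber x)), IsOpen U → U.Nonempty → 0 < measure x U

/-- A normalized left Haar system: a left Haar system together with a normalizing function `κ`. -/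
structure NormalizedLeftHaarSystem [MeasurableSpace Γ] extends G.LeftHaarSystem where
  κ : X → ℝ
  smooth_κ : CkOn (⊤ : ℕ∞) κ Set.univ
  κ_nonneg : ∀ x, 0 ≤ κ x
  properlySupported : ∀ K : Set X, IsCompact K →
    IsCompact (tsupport (fun h => κ (G.src h)) ∩ G.tgt ⁻¹' K)
  normalized : ∀ x, ∫ h : G.TargetFiber x, κ (G.src h.1) ∂(measure x) = 1

variable {G}

namespace NormalizedLeftHaarSystem

variable [MeasurableSpace Γ] (ν : G.NormalizedLeftHaarSystem)

/-- The measure `ν_x` on the target fiber at `x`, with density `κ ∘ s` with respect to `μ_x`. -/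
def fiberMeasure (x : X) : Measure (G.TargetFiber x) :=
  (ν.measure x).withDensity fun h => ENNReal.ofReal (ν.κ (G.src h.1))

variable {P : Type w} [TopologicalSpace P] [DiffManifold P]

/-- The restriction `h ↦ ϑ(y, h)` of a section of `pr_P^*E` to the target fiber at `f y`. -/
def integrand (f : DiffMap P X) {E : P → Type*}
    (θ : ∀ q, Pullback (FiberProd.proj f G.tgt) E q) (y : P) (h : G.TargetFiber (f y)) : E y :=
  θ (FiberProd.mk y h.1 h.2.symm)

/-- The section `y ↦ ∫ ϑ(y, h) dν_{f y}(h)` of `E`, for `ϑ` a section of `pr_P^*E`. -/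
def integral (𝕂 : Type) [RCLike 𝕂] (f : DiffMap P X) {E : P → Type*}
    [∀ y, AddCommGroup (E y)] [∀ y, Module 𝕂 (E y)] [DiffVectorBundle 𝕂 E]
    (θ : ∀ q, Pullback (FiberProd.proj f G.tgt) E q) (y : P) : E y :=
  haveI := DiffVectorBundle.finiteDimensional 𝕂 E y
  vectorIntegral 𝕂 (integrand f θ y) (ν.fiberMeasure (f y))

end NormalizedLeftHaarSystem

end DiffGroupoid

end

/-! The statement is local on `P` and reduces to differentiation under the integral sign over a
fixed compact set. Take a chart `χ` of `P`, a trivialization `τ` of `E`, and a compact set `K` in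
both domains. Since `X` is locally compact, `f(K)` lies in the interior of a compact `K'`. The
support condition on `κ` makes `supp (κ ∘ s) ∩ t⁻¹(K')` compact, so finitely many submersion charts
of `t` cover it. Smooth bump functions then split `κ ∘ s`, over the interior of `K'`, into finitely
many weights, each supported in a compact subset of one submersion chart (`exists_weights`).

In such a chart the Haar measure is Lebesgue measure times a smooth density coefficient, so each
piece of `τ (∫ θ dν)` becomes an ordinary integral `∫ F (a, v) dv`, where `F` is weight times
coefficient times components of `θ` (`integral_fiber_eq_integral_localIntegrand`). Extended by zero,
`F` is still `C^k` and vanishes for `v` outside a compact set independent of `a`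
(`contDiffOn_localIntegrand`). Hence the integral is `C^k`, and its derivatives are bounded by those
of `F` times a volume (`norm_iteratedFDeriv_integral_le`).

By the Leibniz rule the derivatives of `F` over a compact set are bounded by a constant times one
seminorm of `θ`, because the scalar factor does not depend on `θ`
(`exists_norm_iteratedFDeriv_localIntegrand_le`). Summing over the pieces gives regularity and the
continuity estimate together (`exists_local_bound`). -/

/-! ### Differentiation under the integral sign for integrands with uniformly compact support. -/

section ParametricIntegral

theorem norm_integral_le_of_eq_zero {V W : Type*} [TopologicalSpace V] [T2Space V]
    [MeasurableSpace V] [OpensMeasurableSpace V] [NormedAddCommGroup W] [NormedSpace ℝ W]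
    {μ : Measure V} [IsFiniteMeasureOnCompacts μ] {g : V → W} {L : Set V} (hL : IsCompact L) {M : ℝ}
    (hz : ∀ v ∉ L, g v = 0) (hM : ∀ v, ‖g v‖ ≤ M) :
    ‖∫ v, g v ∂μ‖ ≤ M * μ.real L := by
  rw [← setIntegral_eq_integral_of_forall_compl_eq_zero hz]
  exact norm_setIntegral_le_of_norm_le_const hL.measure_lt_top fun v _ => hM v

variable {H V W : Type} [NormedAddCommGroup H] [NormedSpace ℝ H]
  [NormedAddCommGroup V] [NormedSpace ℝ V] [NormedAddCommGroup W] [NormedSpace ℝ W]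

/-- The partial derivative in the first variable of a function of two variables. -/
noncomputable def partialFDeriv (F : H × V → W) (c : H × V) : H →L[ℝ] W :=
  (fderiv ℝ F c).comp (ContinuousLinearMap.inl ℝ H V)

/-- Because the complement of `L` is open, `F` vanishes near `(a, v)` and not only at that point.
The support condition thus passes to derivatives with the same `L`, which keeps the inductions on
the order going. -/
theorem partialFDeriv_eq_zero {F : H × V → W} {U : Set H} {L : Set V} (hU : IsOpen U)
    (hL : IsClosed L) (hz : ∀ a ∈ U, ∀ v ∉ L, F (a, v) = 0) :
    ∀ a ∈ U, ∀ v ∉ L, partialFDeriv F (a, v) = 0 := by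
  intro a ha v hv
  have : F =ᶠ[𝓝 (a, v)] fun _ => 0 := by
    filter_upwards [(hU.prod hL.isOpen_compl).mem_nhds ⟨ha, hv⟩] with c hc
    exact hz c.1 hc.1 c.2 hc.2
  simp [partialFDeriv, this.fderiv_eq]

theorem ContDiffOn.partialFDeriv {F : H × V → W} {U : Set (H × V)} (hU : IsOpen U)
    {n : WithTop ℕ∞} (hF : ContDiffOn ℝ (n + 1) F U) :
    ContDiffOn ℝ n (partialFDeriv F) U :=
  (hF.fderiv_of_isOpen hU le_rfl).clm_comp contDiffOn_const

/-- Restriction of a linear map to the first factor has norm at most one, so no constants accumulate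
when the estimate is iterated. -/
theorem norm_iteratedFDeriv_partialFDeriv_le {F : H × V → W} {n : ℕ} {c : H × V}
    (hF : ContDiffAt ℝ (n + 1) F c) :
    ‖iteratedFDeriv ℝ n (partialFDeriv F) c‖ ≤ ‖iteratedFDeriv ℝ (n + 1) F c‖ := by
  have h := ((ContinuousLinearMap.compL ℝ H (H × V) W).flip
    (ContinuousLinearMap.inl ℝ H V)).norm_iteratedFDeriv_comp_left
    (hF.fderiv_right (m := n) le_rfl) le_rfl
  rw [norm_iteratedFDeriv_fderiv] at h
  refine h.trans (mul_le_of_le_one_left (norm_nonneg _) ?_)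
  refine ContinuousLinearMap.opNorm_le_bound _ zero_le_one fun T => ?_
  rw [one_mul]
  refine (ContinuousLinearMap.opNorm_comp_le T _).trans ?_
  exact mul_le_of_le_one_right (norm_nonneg _) (ContinuousLinearMap.norm_inl_le_one ℝ H V)

variable [ProperSpace H] [ProperSpace V] [MeasurableSpace V] [BorelSpace V] {μ : Measure V}
  [IsFiniteMeasureOnCompacts μ]

/-- Dominated differentiation: on `N × L`, with `N` a compact neighbourhood of `a` inside `U`, the
partial derivative is bounded by continuity, and off `L` it vanishes. A constant multiple of the
indicator of `L` is therefore an integrable bound. -/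
theorem hasFDerivAt_integral_of_contDiffOn {F : H × V → W} {U : Set H} {L : Set V}
    (hU : IsOpen U) (hL : IsCompact L) (hF : ContDiffOn ℝ 1 F (U ×ˢ Set.univ))
    (hz : ∀ a ∈ U, ∀ v ∉ L, F (a, v) = 0) {a : H} (ha : a ∈ U) :
    HasFDerivAt (fun a => ∫ v, F (a, v) ∂μ) (∫ v, partialFDeriv F (a, v) ∂μ) a := by
  have hO : IsOpen (U ×ˢ (Set.univ : Set V)) := hU.prod isOpen_univ
  have hc : ContinuousOn (partialFDeriv F) (U ×ˢ Set.univ) :=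
    (ContDiffOn.partialFDeriv (n := 0) hO (by simpa using hF)).continuousOn
  have cont : ∀ {W' : Type} [NormedAddCommGroup W'] {g : H × V → W'} {b : H},
      ContinuousOn g (U ×ˢ Set.univ) → b ∈ U → Continuous fun v => g (b, v) := by
    intro W' _ g b hg hb
    exact hg.comp_continuous (by fun_prop) fun v => ⟨hb, trivial⟩
  obtain ⟨N, hN, haN, hNU⟩ := exists_compact_subset hU ha
  obtain ⟨M, hM⟩ := (hN.prod hL).exists_bound_of_continuousOn
    (hc.mono (Set.prod_mono hNU (Set.subset_univ L)))
  refine hasFDerivAt_integral_of_dominated_of_fderiv_le (𝕜 := ℝ) (s := N) (bound := L.indicator fun _ => M)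
    (F := fun a v => F (a, v)) (F' := fun a v => partialFDeriv F (a, v)) (mem_interior_iff_mem_nhds.1 haN) ?_ ?_ ?_ ?_ ?_ ?_
  · filter_upwards [hU.mem_nhds ha] with b hb
    exact (cont hF.continuousOn hb).aestronglyMeasurable
  · exact (cont hF.continuousOn ha).integrable_of_hasCompactSupport
      (HasCompactSupport.intro hL (hz a ha))
  · exact (cont hc ha).aestronglyMeasurable
  · refine Filter.Eventually.of_forall fun v b hb => ?_
    by_cases hv : v ∈ L
    · simpa [hv] using hM (b, v) ⟨hb, hv⟩
    · simp [hv, partialFDeriv_eq_zero hU hL.isClosed hz b (hNU hb) v hv]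
  · exact (integrable_indicator_iff hL.measurableSet).2
      (integrableOn_const hL.measure_lt_top.ne)
  · refine Filter.Eventually.of_forall fun v b hb => ?_
    have h := ((hF.contDiffAt (hO.mem_nhds ⟨hNU hb, trivial⟩)).differentiableAt
      one_ne_zero).hasFDerivAt (x := (b, v))
    exact h.comp b (hasFDerivAt_prodMk_left b v)

/-- The derivative of the integral is the integral of `partialFDeriv F`, whose values lie in `H
→L[ℝ] W`; hence the induction runs over all target spaces `W` at once. -/
theorem contDiffOn_integral_nat {U : Set H} {L : Set V} (hU : IsOpen U) (hL : IsCompact L)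
    (n : ℕ) {W : Type} [NormedAddCommGroup W] [NormedSpace ℝ W] {F : H × V → W}
    (hF : ContDiffOn ℝ n F (U ×ˢ Set.univ)) (hz : ∀ a ∈ U, ∀ v ∉ L, F (a, v) = 0) :
    ContDiffOn ℝ n (fun a => ∫ v, F (a, v) ∂μ) U := by
  have hO : IsOpen (U ×ˢ (Set.univ : Set V)) := hU.prod isOpen_univ
  induction n generalizing W with
  | zero =>
    simp only [Nat.cast_zero, contDiffOn_zero] at hF ⊢
    exact continuousOn_integral_of_compact_support hL hF fun p x hp hx => hz p hp x hx
  | succ n ih =>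
    have h1 := hF.of_le (show (1 : WithTop ℕ∞) ≤ ((n + 1 : ℕ) : WithTop ℕ∞) by
      exact_mod_cast Nat.succ_le_succ (Nat.zero_le n))
    have hd := fun a (ha : a ∈ U) => hasFDerivAt_integral_of_contDiffOn (μ := μ) hU hL h1 hz ha
    push_cast at hF ⊢
    refine (contDiffOn_succ_iff_fderiv_of_isOpen hU).2
      ⟨fun a ha => (hd a ha).differentiableAt.differentiableWithinAt, by simp, ?_⟩
    exact (ih (hF.partialFDeriv hO) (partialFDeriv_eq_zero hU hL.isClosed hz)).congr
      fun a ha => (hd a ha).fderiv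

theorem contDiffOn_integral_of_compact {U : Set H} {L : Set V} (hU : IsOpen U) (hL : IsCompact L)
    {k : ℕ∞} {F : H × V → W} (hF : ContDiffOn ℝ k F (U ×ˢ Set.univ))
    (hz : ∀ a ∈ U, ∀ v ∉ L, F (a, v) = 0) :
    ContDiffOn ℝ k (fun a => ∫ v, F (a, v) ∂μ) U := by
  refine contDiffOn_iff_forall_nat_le.2 fun n hn => ?_
  exact contDiffOn_integral_nat hU hL n (hF.of_le (by exact_mod_cast hn)) hz

/-- Each induction step trades a derivative of the integral for a partial derivative of the
integrand. At order zero only the bound times the measure of `L` remains. -/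
theorem norm_iteratedFDeriv_integral_le {U : Set H} {L : Set V} (hU : IsOpen U) (hL : IsCompact L)
    (n : ℕ) {W : Type} [NormedAddCommGroup W] [NormedSpace ℝ W] {F : H × V → W}
    (hF : ContDiffOn ℝ n F (U ×ˢ Set.univ)) (hz : ∀ a ∈ U, ∀ v ∉ L, F (a, v) = 0) {a : H}
    (ha : a ∈ U) {M : ℝ} (hM : ∀ v, ‖iteratedFDeriv ℝ n F (a, v)‖ ≤ M) :
    ‖iteratedFDeriv ℝ n (fun a => ∫ v, F (a, v) ∂μ) a‖ ≤ M * μ.real L := by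
  have hO : IsOpen (U ×ˢ (Set.univ : Set V)) := hU.prod isOpen_univ
  induction n generalizing W with
  | zero =>
    simp only [norm_iteratedFDeriv_zero] at hM ⊢
    exact norm_integral_le_of_eq_zero hL (hz a ha) hM
  | succ n ih =>
    have h1 := hF.of_le (show (1 : WithTop ℕ∞) ≤ ((n + 1 : ℕ) : WithTop ℕ∞) by
      exact_mod_cast Nat.succ_le_succ (Nat.zero_le n))
    have hd : fderiv ℝ (fun a => ∫ v, F (a, v) ∂μ) =ᶠ[𝓝 a]
        fun a => ∫ v, partialFDeriv F (a, v) ∂μ := by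
      filter_upwards [hU.mem_nhds ha] with b hb
      exact (hasFDerivAt_integral_of_contDiffOn hU hL h1 hz hb).fderiv
    rw [← norm_iteratedFDeriv_fderiv, (hd.iteratedFDeriv ℝ n).eq_of_nhds]
    push_cast at hF
    refine ih (hF.partialFDeriv hO) (partialFDeriv_eq_zero hU hL.isClosed hz) fun v => ?_
    exact (norm_iteratedFDeriv_partialFDeriv_le
      (hF.contDiffAt (hO.mem_nhds ⟨ha, trivial⟩))).trans (hM v)

end ParametricIntegral

/-! ### Functions of class `C^k` on manifolds, bump functions and local compactness. -/

section SmoothFunctions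

variable {M : Type*} [TopologicalSpace M] [DiffManifold M] {F : Type*} [NormedAddCommGroup F]
  [NormedSpace ℝ F] {k : ℕ∞} {U : Set M}

/-- `CkOn` tests only charts with values in `ℝⁿ`. Submersion charts and `fiberChart` take values in
products, and a change to an atlas chart near each point covers them. -/
theorem CkOn.contDiffOn {F' : Type*} [NormedAddCommGroup F'] [NormedSpace ℝ F'] {g : M → F}
    (hg : CkOn k g U) (hU : IsOpen U) {φ : OpenPartialHomeomorph M F'} (hφ : IsSmoothChart φ) :
    ContDiffOn ℝ k (g ∘ φ.symm) (φ.target ∩ φ.symm ⁻¹' U) := by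
  rintro a ⟨ha, hb⟩
  obtain ⟨c, hc, hx⟩ := DiffManifold.exists_chart (φ.symm a)
  have hc' := isSmoothChart_of_mem_atlas hc
  have o1 : IsOpen (φ.target ∩ φ.symm ⁻¹' c.2.source) :=
    φ.symm.isOpen_inter_preimage c.2.open_source
  have o2 : IsOpen (c.2.target ∩ c.2.symm ⁻¹' U) := c.2.symm.isOpen_inter_preimage hU
  have a1 : ContDiffAt ℝ ∞ (c.2 ∘ φ.symm) a :=
    (hφ.transition hc').contDiffAt (o1.mem_nhds ⟨ha, hx⟩)
  have a2 : ContDiffAt ℝ k (g ∘ c.2.symm) ((c.2 ∘ φ.symm) a) := by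
    refine (hg c.2 hc').contDiffAt (o2.mem_nhds ⟨c.2.map_source hx, ?_⟩)
    simpa [c.2.left_inv hx] using hb
  refine ((a2.comp a (a1.of_le (by exact_mod_cast le_top))).congr_of_eventuallyEq
    ?_).contDiffWithinAt
  filter_upwards [o1.mem_nhds ⟨ha, hx⟩] with b hb
  simp [c.2.left_inv hb.2]

theorem CkOn.continuousOn {g : M → F} (hg : CkOn k g U) (hU : IsOpen U) : ContinuousOn g U := by
  intro x hx
  obtain ⟨c, hc, hxc⟩ := DiffManifold.exists_chart x
  have o2 : IsOpen (c.2.target ∩ c.2.symm ⁻¹' U) := c.2.symm.isOpen_inter_preimage hU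
  have h : ContinuousAt (g ∘ c.2.symm) (c.2 x) := by
    refine (hg c.2 (isSmoothChart_of_mem_atlas hc)).continuousOn.continuousAt
      (o2.mem_nhds ⟨c.2.map_source hxc, ?_⟩)
    simpa [c.2.left_inv hxc] using hx
  refine ((h.comp (c.2.continuousAt hxc)).congr ?_).continuousWithinAt
  filter_upwards [c.2.open_source.mem_nhds hxc] with z hz
  simp [c.2.left_inv hz]

theorem CkOn.congr {g g' : M → F} (hg : CkOn k g U) (h : Set.EqOn g' g U) : CkOn k g' U :=
  fun _ φ hφ => (hg φ hφ).congr fun _ ha => h ha.2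

theorem CkOn.mono {V : Set M} {g : M → F} (hg : CkOn k g U) (h : V ⊆ U) : CkOn k g V :=
  fun _ φ hφ => (hg φ hφ).mono fun _ ha => ⟨ha.1, h ha.2⟩

theorem CkOn.of_locally {g : M → F}
    (h : ∀ x ∈ U, ∃ V, IsOpen V ∧ x ∈ V ∧ CkOn k g V) : CkOn k g U := by
  rintro n φ hφ a ⟨ha, hb⟩
  obtain ⟨V, hV, hx, hg⟩ := h _ hb
  exact ((hg φ hφ).contDiffAt
    ((φ.symm.isOpen_inter_preimage hV).mem_nhds ⟨ha, hx⟩)).contDiffWithinAt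

theorem ckOn_const (c : F) : CkOn k (fun _ : M => c) U :=
  fun _ _ _ => contDiffOn_const

theorem CkOn.mul {g g' : M → ℝ} (hg : CkOn k g U) (hg' : CkOn k g' U) :
    CkOn k (fun x => g x * g' x) U :=
  fun _ φ hφ => (hg φ hφ).mul (hg' φ hφ)

theorem CkOn.div {g g' : M → ℝ} (hg : CkOn k g U) (hg' : CkOn k g' U)
    (h : ∀ x ∈ U, g' x ≠ 0) : CkOn k (fun x => g x / g' x) U :=
  fun _ φ hφ => (hg φ hφ).div (hg' φ hφ) fun _ ha => h _ ha.2

theorem CkOn.sum {ι : Type*} {s : Finset ι} {g : ι → M → F} (hg : ∀ i ∈ s, CkOn k (g i) U) :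
    CkOn k (fun x => ∑ i ∈ s, g i x) U :=
  fun _ φ hφ => ContDiffOn.sum fun i hi => hg i hi φ hφ

/-- Bump functions supported in the domain of a chart of a Hausdorff manifold. -/
theorem exists_bump [T2Space M] [FiniteDimensional ℝ F] {φ : OpenPartialHomeomorph M F}
    (hφ : IsSmoothChart φ) {z : M} (hz : z ∈ φ.source) :
    ∃ b : M → ℝ, CkOn (⊤ : ℕ∞) b Set.univ ∧ (∀ x, 0 ≤ b x) ∧ 0 < b z ∧
      ∃ L : Set M, IsCompact L ∧ L ⊆ φ.source ∧ ∀ x ∉ L, b x = 0 := by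
  classical
  obtain ⟨ε, hε, hball⟩ := Metric.mem_nhds_iff.1 (φ.open_target.mem_nhds (φ.map_source hz))
  -- The outer radius `ε / 2` keeps the closed support ball inside the `ε`-ball, hence inside the
  -- chart target, so that its preimage `L` is compact.
  let β : ContDiffBump (φ z) := ⟨ε / 4, ε / 2, by positivity, by linarith⟩
  have hβ : Metric.closedBall (φ z) (ε / 2) ⊆ φ.target :=
    (Metric.closedBall_subset_ball (by linarith)).trans hball
  have : ProperSpace F := FiniteDimensional.proper ℝ F
  set L : Set M := φ.symm '' Metric.closedBall (φ z) (ε / 2) with hL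
  have hLc : IsCompact L :=
    (isCompact_closedBall _ _).image_of_continuousOn (φ.symm.continuousOn.mono hβ)
  have hLs : L ⊆ φ.source := by
    rintro _ ⟨a, ha, rfl⟩
    exact φ.map_target (hβ ha)
  set b : M → ℝ := φ.source.indicator fun x => β (φ x) with hb
  have hb0 : ∀ x ∉ L, b x = 0 := by
    intro x hx
    by_cases hxs : x ∈ φ.source
    · rw [hb, Set.indicator_of_mem hxs]
      refine β.zero_of_le_dist (le_of_not_gt fun h => hx ⟨φ x, ?_, φ.left_inv hxs⟩)
      exact h.le
    · exact Set.indicator_of_notMem hxs _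
  refine ⟨b, ?_, ?_, ?_, L, hLc, hLs, hb0⟩
  -- The chart domain and the complement of `L` cover `M`; the latter is open because compact sets
  -- in a Hausdorff space are closed.
  · refine CkOn.of_locally fun x _ => ?_
    by_cases hxs : x ∈ φ.source
    · refine ⟨φ.source, φ.open_source, hxs, ?_⟩
      refine CkOn.congr (g := fun x => β (φ x)) ?_ fun y hy => Set.indicator_of_mem hy _
      intro n ψ hψ
      exact β.contDiff.comp_contDiffOn (IsSmoothChart.transition hψ hφ)
    · refine ⟨Lᶜ, hLc.isClosed.isOpen_compl, fun h => hxs (hLs h), ?_⟩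
      exact (ckOn_const 0).congr hb0
  · exact fun x => Set.indicator_nonneg (fun x _ => β.nonneg) x
  · rw [hb, Set.indicator_of_mem hz]
    exact β.pos_of_mem_ball (Metric.mem_ball_self (by positivity))

theorem weaklyLocallyCompactSpace : WeaklyLocallyCompactSpace M := by
  refine ⟨fun x => ?_⟩
  obtain ⟨c, -, hx⟩ := DiffManifold.exists_chart x
  obtain ⟨K, hK, hcK, hKt⟩ := exists_compact_subset c.2.open_target (c.2.map_source hx)
  refine ⟨c.2.symm '' K, hK.image_of_continuousOn (c.2.symm.continuousOn.mono hKt), ?_⟩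
  have h := c.2.symm.image_mem_nhds (c.2.map_source hx) (mem_interior_iff_mem_nhds.1 hcK)
  rwa [c.2.left_inv hx] at h

end SmoothFunctions

/-! ### Smooth trivializations and their pullbacks. -/

section Bundle

variable {𝕂 : Type} [RCLike 𝕂] {M N : Type*} [TopologicalSpace M] [TopologicalSpace N]
  [DiffManifold M] [DiffManifold N] {E : N → Type*} [∀ x, AddCommGroup (E x)]
  [∀ x, Module 𝕂 (E x)]

theorem LocalTriv.isSmooth_of_mem_atlas [DiffVectorBundle 𝕂 E] {τ : LocalTriv 𝕂 E}
    (hτ : τ ∈ DiffVectorBundle.atlas (𝕂 := 𝕂) (E := E)) : τ.IsSmooth :=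
  fun σ hσ => ⟨DiffVectorBundle.compatible τ hτ σ hσ, DiffVectorBundle.compatible σ hσ τ hτ⟩

theorem LocalTriv.SmoothTransition.pullback {τ τ' : LocalTriv 𝕂 E} (h : τ.SmoothTransition τ')
    (f : DiffMap M N) : (τ.pullback f).SmoothTransition (τ'.pullback f) := by
  obtain ⟨A, hA, hA'⟩ := h
  exact ⟨fun x => A (f x),
    fun i j => (hA i j).comp_diffMap (τ.isOpen_baseSet.inter τ'.isOpen_baseSet) f,
    fun x hx e => hA' (f x) hx e⟩

theorem LocalTriv.IsSmooth.pullback [DiffVectorBundle 𝕂 E] {τ : LocalTriv 𝕂 E} (hτ : τ.IsSmooth) (f : DiffMap M N) :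
    (τ.pullback f).IsSmooth := by
  rintro _ ⟨σ, hσ, rfl⟩
  exact ⟨(hτ σ hσ).1.pullback f, (hτ σ hσ).2.pullback f⟩

end Bundle

/-! ### Fiber integrals in submersion coordinates. -/

section FiberIntegral

variable {Z Y : Type*} [TopologicalSpace Z] [TopologicalSpace Y] [DiffManifold Z] [DiffManifold Y]
  {f : Z → Y} {m n : ℕ}

theorem SubmersionChart.map_symm (σ : SubmersionChart f m n) {y : Y}
    (hy : y ∈ σ.baseChart.source) {v : Fin m → ℝ} (hv : (v, σ.baseChart y) ∈ σ.chart.target) :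
    f (σ.chart.symm (v, σ.baseChart y)) = y := by
  have hz := σ.chart.map_target hv
  refine σ.baseChart.injOn (σ.mapsTo _ hz) hy ?_
  rw [← σ.eq_proj _ hz, σ.chart.right_inv hv]

variable [MeasurableSpace Z] [BorelSpace Z] {W : Type*} [NormedAddCommGroup W] [NormedSpace ℝ W]

/-- Integrals over a fiber, computed in the vertical coordinates of a submersion chart. -/
theorem VerticalVolumeDensity.IsFiberMeasure.integral_eq {δ : VerticalVolumeDensity f} {y : Y}
    {μ : Measure {z : Z // f z = y}} (hμ : δ.IsFiberMeasure y μ) (σ : SubmersionChart f m n)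
    {g : {z : Z // f z = y} → W} (hg : AEStronglyMeasurable g μ)
    (hg0 : ∀ z, z.1 ∉ σ.chart.source → g z = 0) {F : (Fin m → ℝ) → W}
    (hF : ∀ z : {z : Z // f z = y}, z.1 ∈ σ.chart.source →
      F (σ.chart z.1).1 = δ.coeff σ z.1 • g z)
    (hF0 : ∀ v, (∀ z : {z : Z // f z = y}, z.1 ∈ σ.chart.source → (σ.chart z.1).1 ≠ v) →
      F v = 0) :
    ∫ z, g z ∂μ = ∫ v, F v := by
  classical
  by_cases hne : ∃ z : {z : Z // f z = y}, z.1 ∈ σ.chart.source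
  swap
  · push Not at hne
    have e1 : g = 0 := funext fun z => hg0 z (hne z)
    have e2 : F = 0 := funext fun v => hF0 v fun z hz => absurd hz (hne z)
    simp [e1, e2]
  obtain ⟨z₀, hz₀⟩ := hne
  have hy : y ∈ σ.baseChart.source := z₀.2 ▸ σ.mapsTo _ hz₀
  set S : Set {z : Z // f z = y} := {z | z.1 ∈ σ.chart.source} with hS
  have hSo : IsOpen S := σ.chart.open_source.preimage continuous_subtype_val
  set T : Set (Fin m → ℝ) := {v | (v, σ.baseChart y) ∈ σ.chart.target} with hT
  have hTo : IsOpen T := σ.chart.open_target.preimage (by fun_prop)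
  set s : (Fin m → ℝ) → Z := fun v => σ.chart.symm (v, σ.baseChart y) with hs
  have hsc : ContinuousOn s T :=
    σ.chart.symm.continuousOn.comp (by fun_prop) fun v hv => hv
  have hsS : ∀ v ∈ T, s v ∈ σ.chart.source := fun v hv => σ.chart.map_target hv
  -- The inverse of the vertical coordinate on the fiber, made total by the value `z₀` outside `T`
  -- so that a push-forward along it makes sense. This is why the case of a chart missing the fiber
  -- is treated apart.
  set r : (Fin m → ℝ) → {z : Z // f z = y} :=
    fun v => if hv : v ∈ T then ⟨s v, σ.map_symm hy hv⟩ else z₀ with hr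
  have hr1 : ∀ v ∈ T, (r v).1 = s v := fun v hv => by simp [hr, hv]
  have hσr : ∀ v ∈ T, (σ.chart (r v).1).1 = v := fun v hv => by
    rw [hr1 v hv, hs, σ.chart.right_inv hv]
  have hrc : ContinuousOn r T :=
    Topology.IsInducing.subtypeVal.continuousOn_iff.2 (hsc.congr hr1)
  have hrm : Measurable r := by
    have e : r = T.piecewise r fun _ => z₀ := by
      funext v
      by_cases hv : v ∈ T <;> simp [hr, hv]
    rw [e]
    exact hrc.measurable_piecewise continuousOn_const hTo.measurableSet
  have hST : ∀ z ∈ S, (σ.chart z.1).1 ∈ T ∧ r (σ.chart z.1).1 = z := by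
    intro z hz
    have e : σ.chart z.1 = ((σ.chart z.1).1, σ.baseChart y) :=
      Prod.ext rfl ((σ.eq_proj _ hz).trans (congrArg σ.baseChart z.2))
    have hv : (σ.chart z.1).1 ∈ T := by
      change ((σ.chart z.1).1, σ.baseChart y) ∈ σ.chart.target
      rw [← e]
      exact σ.chart.map_source hz
    refine ⟨hv, Subtype.ext ?_⟩
    rw [hr1 _ hv, hs]
    simp only
    rw [← e, σ.chart.left_inv hz]
  set ρ : (Fin m → ℝ) → ENNReal := fun v => ENNReal.ofReal (δ.coeff σ (s v)) with hρ
  -- `IsFiberMeasure` gives the measure of sets only. Recast as an equality of measures, it yields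
  -- the integral formula by change of variables.
  have hmap : μ.restrict S = ((volume.restrict T).withDensity ρ).map r := by
    ext A hA
    rw [Measure.map_apply hrm hA, withDensity_apply _ (hrm hA), Measure.restrict_apply hA,
      Measure.restrict_restrict (hrm hA),
      hμ σ (A ∩ S) (hA.inter hSo.measurableSet) fun z hz => hz.2]
    congr 2
    ext v
    constructor
    · rintro ⟨z, ⟨hzA, hzS⟩, rfl⟩
      refine ⟨?_, (hST z hzS).1⟩
      change r _ ∈ A
      rwa [(hST z hzS).2]
    · rintro ⟨hvA, hvT⟩
      refine ⟨r v, ⟨hvA, ?_⟩, hσr v hvT⟩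
      change (r v).1 ∈ σ.chart.source
      rw [hr1 v hvT]
      exact hsS v hvT
  have hρm : AEMeasurable ρ (volume.restrict T) := by
    have h := ((δ.smooth_coeff σ).continuousOn σ.chart.open_source).comp hsc hsS
    exact (h.aemeasurable hTo.measurableSet).ennreal_ofReal
  rw [← setIntegral_eq_integral_of_forall_compl_eq_zero (s := S) fun z hz => hg0 z hz, hmap,
    integral_map hrm.aemeasurable (by rw [← hmap]; exact hg.restrict),
    integral_withDensity_eq_integral_toReal_smul₀ hρm (by simp [hρ]),
    ← setIntegral_eq_integral_of_forall_compl_eq_zero (s := T) (f := F)]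
  · refine setIntegral_congr_fun hTo.measurableSet fun v hv => ?_
    have hz : (r v).1 ∈ σ.chart.source := (hr1 v hv).symm ▸ hsS v hv
    have h := hF (r v) hz
    rw [hσr v hv] at h
    simp only [h, hρ]
    rw [ENNReal.toReal_ofReal (δ.coeff_pos σ _ (hsS v hv)).le, hr1 v hv]
  · exact fun v hv => hF0 v fun z hz e => hv (e ▸ (hST z hz).1)

end FiberIntegral

/-! ### The integrand in coordinates of the fiber product, its regularity and its derivative bounds.
-/

section LocalIntegral

variable {P Z Y : Type*} [TopologicalSpace P] [TopologicalSpace Z] [TopologicalSpace Y]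
  [DiffManifold P] [DiffManifold Z] [DiffManifold Y] {f : DiffMap P Y} {t : Submersion Z Y}
  {p m n : ℕ} {𝕂 : Type} [RCLike 𝕂] {E : P → Type*} [∀ y, AddCommGroup (E y)]
  [∀ y, Module 𝕂 (E y)]

open FiberProd

/-- The scalar factor `w · δ`, in the coordinates of the chart `fiberChart` of the fiber product. -/
noncomputable def localWeight (χ : OpenPartialHomeomorph P (Fin p → ℝ))
    (σ : SubmersionChart t m n) (q₀ : FiberProd f t) (δ : VerticalVolumeDensity t) (w : Z → ℝ)
    (c : (Fin p → ℝ) × (Fin m → ℝ)) : ℝ :=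
  w (chartInv χ σ q₀ c).snd * δ.coeff σ (chartInv χ σ q₀ c).snd

/-- The components of a section of the pullback bundle, in the coordinates of the chart
`fiberChart`. -/
noncomputable def localComponents (χ : OpenPartialHomeomorph P (Fin p → ℝ))
    (σ : SubmersionChart t m n) (q₀ : FiberProd f t) (τ : LocalTriv 𝕂 E)
    (θ : ∀ q, Pullback (FiberProd.proj f t) E q)
    (c : (Fin p → ℝ) × (Fin m → ℝ)) : Fin τ.rank → 𝕂 :=
  τ.coord (chartInv χ σ q₀ c).fst (θ (chartInv χ σ q₀ c))

/-- The integrand of the fiber integral, in the coordinates of the chart `fiberChart`, extended by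
zero. -/
noncomputable def localIntegrand (χ : OpenPartialHomeomorph P (Fin p → ℝ))
    (σ : SubmersionChart t m n) (q₀ : FiberProd f t) (δ : VerticalVolumeDensity t) (w : Z → ℝ)
    (τ : LocalTriv 𝕂 E) (θ : ∀ q, Pullback (FiberProd.proj f t) E q) :
    (Fin p → ℝ) × (Fin m → ℝ) → Fin τ.rank → 𝕂 :=
  (chartTarget χ σ f).indicator fun c =>
    localWeight χ σ q₀ δ w c • localComponents χ σ q₀ τ θ c

variable {χ : OpenPartialHomeomorph P (Fin p → ℝ)} {σ : SubmersionChart t m n}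
  {q₀ : FiberProd f t} {δ : VerticalVolumeDensity t} {w : Z → ℝ} {O : Set Y} {L : Set Z}
  {τ : LocalTriv 𝕂 E} {k : ℕ∞}

/-- The coordinates of the points over which a section of the given bundle can be integrated. -/
def integralDomain (χ : OpenPartialHomeomorph P (Fin p → ℝ)) (τ : LocalTriv 𝕂 E)
    (f : DiffMap P Y) (O : Set Y) : Set (Fin p → ℝ) :=
  χ.target ∩ χ.symm ⁻¹' (τ.baseSet ∩ f ⁻¹' O)

theorem isOpen_integralDomain (hO : IsOpen O) : IsOpen (integralDomain χ τ f O) :=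
  χ.symm.isOpen_inter_preimage (τ.isOpen_baseSet.inter (hO.preimage f.continuous_toFun))

/-- The arrow with coordinates `c` is `σ.chart.symm` of a point depending smoothly on `c`.
Restriction to points over `O` is needed because the weights are smooth only over `O`. -/
theorem contDiffOn_localWeight (hχ : IsSmoothChart χ) (hO : IsOpen O)
    (hw : CkOn (⊤ : ℕ∞) w (t ⁻¹' O)) :
    ContDiffOn ℝ ∞ (localWeight χ σ q₀ δ w)
      (chartTarget χ σ f ∩ integralDomain χ τ f O ×ˢ Set.univ) := by
  have hs : ContDiffOn ℝ ∞ (fun c : (Fin p → ℝ) × (Fin m → ℝ) =>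
      (c.2, (σ.baseChart ∘ f ∘ χ.symm) c.1))
      (chartTarget χ σ f ∩ integralDomain χ τ f O ×ˢ Set.univ) :=
    contDiff_snd.contDiffOn.prodMk ((f.smooth_toFun χ σ.baseChart hχ σ.isSmoothChart_base).comp
      contDiff_fst.contDiffOn fun c hc => hc.1.1)
  have h1 := (hw.contDiffOn (hO.preimage t.continuous_toFun) σ.isSmoothChart).comp hs
    fun c hc => ⟨hc.1.2, ?_⟩
  · have h2 := ((δ.smooth_coeff σ).contDiffOn σ.chart.open_source σ.isSmoothChart).comp hs
      fun c hc => ⟨hc.1.2, σ.chart.map_target hc.1.2⟩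
    refine (h1.mul h2).congr fun c hc => ?_
    simp only [localWeight, chartInv_snd hc.1]
    rfl
  · change t (σ.chart.symm (c.2, σ.baseChart (f (χ.symm c.1)))) ∈ O
    rw [← chartTarget_eq hc.1]
    exact hc.2.1.2.2

theorem contDiffOn_localComponents [DiffVectorBundle 𝕂 E] (hχ : IsSmoothChart χ)
    (hτ : τ.IsSmooth) (θ : CkSection 𝕂 k (Pullback (FiberProd.proj f t) E)) :
    ContDiffOn ℝ k (localComponents χ σ q₀ τ θ)
      (chartTarget χ σ f ∩ integralDomain χ τ f O ×ˢ Set.univ) := by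
  refine (CkOn.contDiffOn (θ.2 _ (hτ.pullback (FiberProd.proj f t)))
    (LocalTriv.isOpen_baseSet _) (isSmoothChart_fiberChart hχ σ q₀)).mono ?_
  rintro c ⟨hc, hc'⟩
  refine ⟨hc, ?_⟩
  change (chartInv χ σ q₀ c).fst ∈ τ.baseSet
  rw [chartInv_fst hc]
  exact hc'.1.2.1

/-- The possible values of `(f y, v)` at points of the fiber product over `L`. -/
def supportShadow (σ : SubmersionChart t m n) (L : Set Z) : Set (Y × (Fin m → ℝ)) :=
  (fun z => (t z, (σ.chart z).1)) '' L

theorem isCompact_supportShadow (hL : IsCompact L) (hLσ : L ⊆ σ.chart.source) :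
    IsCompact (supportShadow σ L) :=
  hL.image_of_continuousOn (t.continuous_toFun.continuousOn.prodMk
    (continuous_fst.comp_continuousOn (σ.chart.continuousOn.mono hLσ)))

/-- If the pair comes from `z ∈ L`, then `(χ.symm c.1, z)` is a point of the fiber product inside
the chart, with coordinates `c`. -/
theorem mem_chartTarget_of_mem_supportShadow (hLσ : L ⊆ σ.chart.source)
    {c : (Fin p → ℝ) × (Fin m → ℝ)} (hc : c.1 ∈ χ.target)
    (h : (f (χ.symm c.1), c.2) ∈ supportShadow σ L) : c ∈ chartTarget χ σ f := by
  obtain ⟨z, hz, e⟩ := h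
  obtain ⟨e1, e2⟩ := Prod.ext_iff.1 e
  simp only at e1 e2
  refine ⟨⟨hc, ?_⟩, ?_⟩
  · rw [← e1]
    exact σ.mapsTo z (hLσ hz)
  · rw [← e1, ← e2, ← σ.eq_proj z (hLσ hz)]
    exact σ.chart.map_source (hLσ hz)

theorem localIntegrand_eq_zero (hw0 : ∀ z ∉ L, w z = 0)
    (θ : ∀ q, Pullback (FiberProd.proj f t) E q) {c : (Fin p → ℝ) × (Fin m → ℝ)}
    (h : (f (χ.symm c.1), c.2) ∉ supportShadow σ L) :
    localIntegrand χ σ q₀ δ w τ θ c = 0 := by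
  by_cases hc : c ∈ chartTarget χ σ f
  · rw [localIntegrand, Set.indicator_of_mem hc, localWeight, hw0, zero_mul, zero_smul]
    refine fun hz => h ⟨_, hz, ?_⟩
    simp only
    rw [chartInv_snd hc, ← chartTarget_eq hc, σ.chart.right_inv hc.2]
  · exact Set.indicator_of_notMem hc _

/-- The shadow is compact, hence closed since `Y` is Hausdorff, and `c ↦ (f (χ.symm c.1), c.2)` is
continuous at points of the chart; so being off the shadow is an open condition there. This holds
also at boundary points of `chartTarget`, where smoothness of the extension by zero is at stake, and
needs no separation property of `P`. -/
theorem localIntegrand_eventuallyEq_zero [T2Space Y] (hL : IsCompact L)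
    (hLσ : L ⊆ σ.chart.source) (hw0 : ∀ z ∉ L, w z = 0)
    (θ : ∀ q, Pullback (FiberProd.proj f t) E q) {c : (Fin p → ℝ) × (Fin m → ℝ)}
    (hc : c.1 ∈ χ.target) (h : (f (χ.symm c.1), c.2) ∉ supportShadow σ L) :
    localIntegrand χ σ q₀ δ w τ θ =ᶠ[𝓝 c] fun _ => 0 := by
  have hcont : ContinuousAt (fun c : (Fin p → ℝ) × (Fin m → ℝ) => (f (χ.symm c.1), c.2)) c :=
    (f.continuous_toFun.continuousAt.comp
      ((χ.symm.continuousAt hc).comp continuousAt_fst)).prodMk continuousAt_snd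
  filter_upwards [hcont.preimage_mem_nhds
    ((isCompact_supportShadow hL hLσ).isClosed.isOpen_compl.mem_nhds h)] with b hb
  exact localIntegrand_eq_zero hw0 θ hb

/-- A point either has its pair in the shadow, and then lies in the open `chartTarget` where the
product formula applies, or has a neighbourhood on which the integrand is zero. -/
theorem contDiffOn_localIntegrand [T2Space Y] [DiffVectorBundle 𝕂 E] (hχ : IsSmoothChart χ)
    (hτ : τ.IsSmooth) (hO : IsOpen O) (hw : CkOn (⊤ : ℕ∞) w (t ⁻¹' O)) (hL : IsCompact L)
    (hLσ : L ⊆ σ.chart.source) (hw0 : ∀ z ∉ L, w z = 0)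
    (θ : CkSection 𝕂 k (Pullback (FiberProd.proj f t) E)) :
    ContDiffOn ℝ k (localIntegrand χ σ q₀ δ w τ θ)
      (integralDomain χ τ f O ×ˢ Set.univ) := by
  intro c hc
  by_cases h : (f (χ.symm c.1), c.2) ∈ supportShadow σ L
  · have hct := mem_chartTarget_of_mem_supportShadow hLσ hc.1.1 h
    have ho := (chartTarget_isOpen χ σ f).inter
      ((isOpen_integralDomain (χ := χ) (τ := τ) (f := f) hO).prod isOpen_univ)
    have h1 := ((contDiffOn_localWeight (σ := σ) (q₀ := q₀) (δ := δ) (τ := τ) hχ hO hw).of_le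
      (show (k : WithTop ℕ∞) ≤ ∞ by exact_mod_cast le_top)).smul
      (contDiffOn_localComponents (σ := σ) (q₀ := q₀) (O := O) hχ hτ θ)
    refine ((h1.contDiffAt (ho.mem_nhds ⟨hct, hc⟩)).congr_of_eventuallyEq
      ?_).contDiffWithinAt
    filter_upwards [(chartTarget_isOpen χ σ f).mem_nhds hct] with b hb
    exact Set.indicator_of_mem hb _
  · exact (contDiffAt_const.congr_of_eventuallyEq
      (localIntegrand_eventuallyEq_zero hL hLσ hw0 θ hc.1.1 h)).contDiffWithinAt

theorem localIntegrand_eq_zero_of_notMem_image (hw0 : ∀ z ∉ L, w z = 0)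
    (θ : ∀ q, Pullback (FiberProd.proj f t) E q) {a : Fin p → ℝ} {v : Fin m → ℝ}
    (hv : v ∉ (fun z => (σ.chart z).1) '' L) :
    localIntegrand χ σ q₀ δ w τ θ (a, v) = 0 := by
  refine localIntegrand_eq_zero hw0 θ ?_
  rintro ⟨z, hz, e⟩
  exact hv ⟨z, hz, (Prod.ext_iff.1 e).2⟩

theorem isCompact_verticalImage (hL : IsCompact L) (hLσ : L ⊆ σ.chart.source) :
    IsCompact ((fun z => (σ.chart z).1) '' L) :=
  hL.image_of_continuousOn (continuous_fst.comp_continuousOn (σ.chart.continuousOn.mono hLσ))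

theorem norm_iteratedFDeriv_smul_le_of_isOpen {G H : Type*} [NormedAddCommGroup G]
    [NormedSpace ℝ G] [NormedAddCommGroup H] [NormedSpace ℝ H] {g : G → ℝ} {h : G → H} {U : Set G}
    {n : ℕ} (hg : ContDiffOn ℝ n g U) (hh : ContDiffOn ℝ n h U) (hU : IsOpen U) {x : G}
    (hx : x ∈ U) :
    ‖iteratedFDeriv ℝ n (fun y => g y • h y) x‖ ≤ ∑ i ∈ Finset.range (n + 1),
      (n.choose i : ℝ) * ‖iteratedFDeriv ℝ i g x‖ * ‖iteratedFDeriv ℝ (n - i) h x‖ := by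
  have := norm_iteratedFDerivWithin_smul_le hg hh hU.uniqueDiffOn hx le_rfl
  simpa only [iteratedFDerivWithin_of_isOpen _ hU hx] using this

theorem ContinuousLinearEquiv.norm_iteratedFDeriv_comp_right_le {G G' H : Type*}
    [NormedAddCommGroup G] [NormedSpace ℝ G] [NormedAddCommGroup G'] [NormedSpace ℝ G']
    [NormedAddCommGroup H] [NormedSpace ℝ H] (e : G ≃L[ℝ] G') (g : G' → H) (x : G) (i : ℕ) :
    ‖iteratedFDeriv ℝ i (g ∘ e) x‖ ≤
      ‖iteratedFDeriv ℝ i g (e x)‖ * ‖(e : G →L[ℝ] G')‖ ^ i := by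
  have h := e.iteratedFDerivWithin_comp_right g uniqueDiffOn_univ (x := x) (Set.mem_univ _) i
  simp only [Set.preimage_univ, iteratedFDerivWithin_univ] at h
  rw [h]
  refine (ContinuousMultilinearMap.norm_compContinuousLinearMap_le _ _).trans ?_
  simp

theorem CkSeminormIndex.le_ckSeminormFamily {M : Type*} [TopologicalSpace M] [DiffManifold M]
    {B : M → Type*} [∀ x, AddCommGroup (B x)] [∀ x, Module 𝕂 (B x)] [DiffVectorBundle 𝕂 B]
    (i : CkSeminormIndex 𝕂 k B) (ξ : CkSection 𝕂 k B) {s : ℕ} (hs : s ≤ i.r) {x : M}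
    (hx : x ∈ i.K) :
    ‖iteratedFDeriv ℝ s (i.localExpr ξ) (i.chart x)‖ ≤ ckSeminormFamily 𝕂 k B i ξ := by
  refine (le_ciSup (i.bddAbove_localExpr hs ξ) ⟨x, hx⟩).trans ?_
  exact Seminorm.le_def.1 (Finset.le_sup (f := i.derivSeminorm)
    (Finset.mem_univ (⟨s, Nat.lt_succ_of_le hs⟩ : Fin (i.r + 1)))) ξ

/-- The derivatives of the local expression of the fiber integral over a compact set are bounded by
a generating seminorm of the `C^k`-topology. -/
theorem exists_norm_iteratedFDeriv_localIntegrand_le [T2Space Y] [DiffVectorBundle 𝕂 E]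
    (hχ : IsSmoothChart χ) (hτ : τ.IsSmooth) (hO : IsOpen O) (hw : CkOn (⊤ : ℕ∞) w (t ⁻¹' O))
    (hL : IsCompact L) (hLσ : L ⊆ σ.chart.source) (hw0 : ∀ z ∉ L, w z = 0) {A : Set (Fin p → ℝ)}
    (hA : IsCompact A) (hAO : A ⊆ integralDomain χ τ f O) (r : ℕ) (hr : (r : ℕ∞) ≤ k) :
    ∃ (i : CkSeminormIndex 𝕂 k (Pullback (FiberProd.proj f t) E)) (C : ℝ), 0 ≤ C ∧
      ∀ θ : CkSection 𝕂 k (Pullback (FiberProd.proj f t) E), ∀ a ∈ A, ∀ v, ∀ s ≤ r,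
        ‖iteratedFDeriv ℝ s (localIntegrand χ σ q₀ δ w τ θ) (a, v)‖ ≤
          C * ckSeminormFamily 𝕂 k _ i θ := by
  set D := chartTarget χ σ f ∩ integralDomain χ τ f O ×ˢ (Set.univ : Set (Fin m → ℝ)) with hD
  have hDo : IsOpen D := (chartTarget_isOpen χ σ f).inter
    ((isOpen_integralDomain (χ := χ) (τ := τ) (f := f) hO).prod isOpen_univ)
  -- The points over `A` at which the integrand may be nonzero. The shadow condition is closed,
  -- which makes `B` compact, and it already forces membership in the open set `D`.
  set B : Set ((Fin p → ℝ) × (Fin m → ℝ)) := A ×ˢ ((fun z => (σ.chart z).1) '' L) ∩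
    (fun c : (Fin p → ℝ) × (Fin m → ℝ) => (f (χ.symm c.1), c.2)) ⁻¹' supportShadow σ L with hB
  have hBc : IsCompact B := by
    have h1 := hA.prod (isCompact_verticalImage hL hLσ)
    refine h1.of_isClosed_subset ?_ Set.inter_subset_left
    refine ContinuousOn.preimage_isClosed_of_isClosed ?_ h1.isClosed
      (isCompact_supportShadow hL hLσ).isClosed
    exact (f.continuous_toFun.comp_continuousOn (χ.symm.continuousOn.comp
      _root_.continuous_fst.continuousOn fun c hc => (hAO hc.1).1)).prodMk
      _root_.continuous_snd.continuousOn
  have hBD : B ⊆ D := fun c hc =>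
    ⟨mem_chartTarget_of_mem_supportShadow hLσ (hAO hc.1.1).1 hc.2, hAO hc.1.1, trivial⟩
  set Φ := fiberChart χ σ q₀ with hΦ
  have hinv : ∀ c ∈ B, Φ (Φ.symm c) = c := fun c hc => Φ.right_inv (hBD hc).1
  -- The controlling seminorm lives on the compact set in the fiber product that corresponds to `B`.
  -- Seminorm charts take values in some `ℝⁿ`, hence the composition with `prodEquiv`.
  let i : CkSeminormIndex 𝕂 k (Pullback (FiberProd.proj f t) E) :=
    { dim := p + m
      chart := Φ.transHomeomorph (prodEquiv p m).toHomeomorph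
      isSmoothChart := isSmoothChart_of_mem_atlas
        (c := ⟨p + m, Φ.transHomeomorph (prodEquiv p m).toHomeomorph⟩)
        ⟨p, m, n, χ, σ, q₀, hχ, rfl⟩
      triv := τ.pullback (FiberProd.proj f t)
      isSmooth_triv := hτ.pullback _
      K := Φ.symm '' B
      isCompact_K := hBc.image_of_continuousOn
        (Φ.symm.continuousOn.mono fun c hc => (hBD hc).1)
      K_subset_source := by
        rintro _ ⟨c, hc, rfl⟩
        exact Φ.map_target (hBD hc).1
      K_subset_baseSet := by
        rintro _ ⟨c, hc, rfl⟩
        change (chartInv χ σ q₀ c).fst ∈ τ.baseSet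
        rw [chartInv_fst (hBD hc).1]
        exact (hBD hc).2.1.2.1
      r := r
      r_le := hr }
  have hW := contDiffOn_localWeight (σ := σ) (q₀ := q₀) (δ := δ) (τ := τ) hχ hO hw
  have hbound : ∀ s : ℕ, ∃ M : ℝ, 0 ≤ M ∧ ∀ c ∈ B,
      ‖iteratedFDeriv ℝ s (localWeight χ σ q₀ δ w) c‖ ≤ M := by
    intro s
    obtain ⟨M, hM⟩ := hBc.exists_bound_of_continuousOn
      (f := iteratedFDeriv ℝ s (localWeight χ σ q₀ δ w)) fun c hc =>
        ((hW.contDiffAt (hDo.mem_nhds (hBD hc))).continuousAt_iteratedFDeriv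
          (by exact_mod_cast le_top)).continuousWithinAt
    exact ⟨max M 0, le_max_right _ _, fun c hc => (hM c hc).trans (le_max_left _ _)⟩
  choose M hM0 hM using hbound
  set N := ‖(prodEquiv p m : ((Fin p → ℝ) × (Fin m → ℝ)) →L[ℝ] (Fin (p + m) → ℝ))‖ with hN
  -- Leibniz constants: binomial coefficient, bound `M j` for the weight, and a power of `N` from
  -- the linear change of coordinates. Their sum over `s ≤ r` below serves all orders at once.
  set C : ℕ → ℝ := fun s =>
    ∑ j ∈ Finset.range (s + 1), (s.choose j : ℝ) * M j * N ^ (s - j) with hC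
  have hC0 : ∀ s, 0 ≤ C s := fun s => Finset.sum_nonneg fun j _ =>
    mul_nonneg (mul_nonneg (Nat.cast_nonneg _) (hM0 j)) (pow_nonneg (norm_nonneg _) _)
  refine ⟨i, ∑ s ∈ Finset.range (r + 1), C s, Finset.sum_nonneg fun s _ => hC0 s,
    fun θ a ha v s hs => ?_⟩
  have hq0 : 0 ≤ ckSeminormFamily 𝕂 k _ i θ := apply_nonneg _ _
  by_cases h : (f (χ.symm a), v) ∈ supportShadow σ L
  swap
  · have e := localIntegrand_eventuallyEq_zero (q₀ := q₀) (δ := δ) (τ := τ) hL hLσ hw0 θ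
      (c := (a, v)) (hAO ha).1 h
    rw [(e.iteratedFDeriv ℝ s).eq_of_nhds, iteratedFDeriv_fun_zero]
    simpa using mul_nonneg (Finset.sum_nonneg fun s _ => hC0 s) hq0
  have hcB : (a, v) ∈ B := by
    refine ⟨⟨ha, ?_⟩, h⟩
    obtain ⟨z, hz, e⟩ := h
    exact ⟨z, hz, (Prod.ext_iff.1 e).2⟩
  have hcD := hBD hcB
  have hrk : ∀ j ≤ r, ((j : ℕ) : WithTop ℕ∞) ≤ ((k : ℕ∞) : WithTop ℕ∞) := fun j hj => by
    exact_mod_cast (Nat.cast_le.2 hj).trans hr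
  have e : localIntegrand χ σ q₀ δ w τ θ =ᶠ[𝓝 (a, v)]
      fun c => localWeight χ σ q₀ δ w c • localComponents χ σ q₀ τ θ c := by
    filter_upwards [(chartTarget_isOpen χ σ f).mem_nhds hcD.1] with b hb
    exact Set.indicator_of_mem hb _
  have hcomp : ∀ j ≤ r, ‖iteratedFDeriv ℝ j (localComponents χ σ q₀ τ θ) (a, v)‖ ≤
      ckSeminormFamily 𝕂 k _ i θ * N ^ j := by
    intro j hj
    have h1 : localComponents χ σ q₀ τ θ = i.localExpr θ ∘ prodEquiv p m := by
      funext c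
      change _ = (τ.pullback _).coord (chartInv χ σ q₀ ((prodEquiv p m).symm (prodEquiv p m c)))
        (θ (chartInv χ σ q₀ ((prodEquiv p m).symm (prodEquiv p m c))))
      rw [ContinuousLinearEquiv.symm_apply_apply]
      rfl
    rw [h1]
    refine ((prodEquiv p m).norm_iteratedFDeriv_comp_right_le _ _ _).trans ?_
    have h2 := i.le_ckSeminormFamily θ (s := j) hj (x := Φ.symm (a, v)) ⟨_, hcB, rfl⟩
    have h3 : i.chart (Φ.symm (a, v)) = prodEquiv p m (a, v) := by
      change prodEquiv p m (Φ (Φ.symm (a, v))) = _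
      rw [hinv _ hcB]
    rw [h3] at h2
    exact mul_le_mul_of_nonneg_right h2 (pow_nonneg (norm_nonneg _) _)
  have hΘ := contDiffOn_localComponents (σ := σ) (q₀ := q₀) (O := O) hχ hτ θ
  rw [(e.iteratedFDeriv ℝ s).eq_of_nhds]
  have h4 := norm_iteratedFDeriv_smul_le_of_isOpen (hW.of_le (show (s : WithTop ℕ∞) ≤ ∞ by
    exact_mod_cast le_top)) (hΘ.of_le (hrk s hs)) hDo hcD
  refine h4.trans (le_trans (b := C s * ckSeminormFamily 𝕂 k _ i θ) ?_ ?_)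
  · rw [hC, Finset.sum_mul]
    refine Finset.sum_le_sum fun j hj => ?_
    have hjs : s - j ≤ r := (Nat.sub_le _ _).trans hs
    calc _ ≤ (s.choose j : ℝ) * M j * (ckSeminormFamily 𝕂 k _ i θ * N ^ (s - j)) := by
          gcongr
          · exact mul_nonneg (Nat.cast_nonneg _) (hM0 j)
          · exact hM j _ hcB
          · exact hcomp _ hjs
      _ = _ := by ring
  · exact mul_le_mul_of_nonneg_right (Finset.single_le_sum (fun s _ => hC0 s)
      (Finset.mem_range.2 (Nat.lt_succ_of_le hs))) hq0

variable [MeasurableSpace Z] [BorelSpace Z]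

/-- On the fiber over `χ.symm a` the vertical coordinate of `σ` is the second coordinate of
`fiberChart`, and the density coefficient is built into `localIntegrand`. -/
theorem integral_fiber_eq_integral_localIntegrand {a : Fin p → ℝ} (ha : a ∈ χ.target)
    {μ : Measure {z : Z // t z = f (χ.symm a)}} (hμ : δ.IsFiberMeasure (f (χ.symm a)) μ)
    (hLσ : L ⊆ σ.chart.source) (hw0 : ∀ z ∉ L, w z = 0)
    (θ : ∀ q, Pullback (FiberProd.proj f t) E q)
    (hg : AEStronglyMeasurable (fun z : {z : Z // t z = f (χ.symm a)} =>
      w z.1 • τ.coord (χ.symm a) (θ (FiberProd.mk (χ.symm a) z.1 z.2.symm))) μ) :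
    ∫ z : {z : Z // t z = f (χ.symm a)},
        w z.1 • τ.coord (χ.symm a) (θ (FiberProd.mk (χ.symm a) z.1 z.2.symm)) ∂μ =
      ∫ v, localIntegrand χ σ q₀ δ w τ θ (a, v) := by
  refine hμ.integral_eq σ hg ?_ ?_ ?_
  · intro z hz
    rw [hw0 _ fun h => hz (hLσ h), zero_smul]
  · intro z hz
    have e : σ.baseChart (f (χ.symm a)) = (σ.chart z.1).2 := by
      rw [σ.eq_proj _ hz, z.2]
    have hc : (a, (σ.chart z.1).1) ∈ chartTarget χ σ f := by
      refine ⟨⟨ha, ?_⟩, ?_⟩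
      · rw [← z.2]
        exact σ.mapsTo _ hz
      · simp only [e]
        exact σ.chart.map_source hz
    have hinv : chartInv χ σ q₀ (a, (σ.chart z.1).1) = FiberProd.mk (χ.symm a) z.1 z.2.symm := by
      refine FiberProd.ext (chartInv_fst hc) ?_
      rw [chartInv_snd hc]
      simp only [e]
      exact σ.chart.left_inv hz
    rw [localIntegrand, Set.indicator_of_mem hc, localWeight, localComponents, hinv, mul_comm]
    exact mul_smul _ _ _
  · intro v hv
    by_cases hc : (a, v) ∈ chartTarget χ σ f
    · refine absurd ?_ (hv ⟨σ.chart.symm (v, σ.baseChart (f (χ.symm a))),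
        σ.map_symm hc.1.2 hc.2⟩ (σ.chart.map_target hc.2))
      simp only [σ.chart.right_inv hc.2]
    · exact Set.indicator_of_notMem hc _

end LocalIntegral

/-! ### Splitting a properly supported function into pieces supported in submersion charts. -/

section Weights

variable {Z Y : Type*} [TopologicalSpace Z] [TopologicalSpace Y] [DiffManifold Z] [DiffManifold Y]
  [T2Space Z]

theorem exists_bumps (t : Submersion Z Y) {C : Set Z} (hC : IsCompact C) :
    ∃ (s : Finset Z) (m n : Z → ℕ) (σ : ∀ z, SubmersionChart t (m z) (n z)) (b : Z → Z → ℝ)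
      (L : Z → Set Z), (∀ z, CkOn (⊤ : ℕ∞) (b z) Set.univ ∧ IsCompact (L z) ∧
        L z ⊆ (σ z).chart.source ∧ ∀ x ∉ L z, b z x = 0) ∧
      ∀ x ∈ C, 0 < ∑ z ∈ s, b z x := by
  choose m n σ hσ using t.exists_submersionChart
  choose b hb hb0 hbz L hL hLσ hbL using fun z => exists_bump (σ z).isSmoothChart (hσ z)
  have ho : ∀ z, IsOpen {x | 0 < b z x} := fun z =>
    isOpen_lt continuous_const (continuousOn_univ.1 ((hb z).continuousOn isOpen_univ))
  obtain ⟨s, -, hs⟩ := hC.elim_nhds_subcover (fun z => {x | 0 < b z x})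
    fun z _ => (ho z).mem_nhds (hbz z)
  refine ⟨s, m, n, σ, b, L, fun z => ⟨hb z, hL z, hLσ z, hbL z⟩, fun x hx => ?_⟩
  obtain ⟨z, hz, hxz⟩ := Set.mem_iUnion₂.1 (hs hx)
  exact Finset.sum_pos' (fun z _ => hb0 z x) ⟨z, hz, hxz⟩

/-- A function with fiberwise compact support is, over a relatively compact open set, a finite sum
of smooth functions with compact supports in submersion charts. -/
theorem exists_weights (t : Submersion Z Y) {ρ : Z → ℝ} (hρ : CkOn (⊤ : ℕ∞) ρ Set.univ)
    {O K : Set Y} (hOK : O ⊆ K) (hK : IsCompact (tsupport ρ ∩ t ⁻¹' K)) :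
    ∃ (s : Finset Z) (m n : Z → ℕ) (σ : ∀ z, SubmersionChart t (m z) (n z)) (w : Z → Z → ℝ)
      (L : Z → Set Z), (∀ z, CkOn (⊤ : ℕ∞) (w z) (t ⁻¹' O) ∧ IsCompact (L z) ∧
        L z ⊆ (σ z).chart.source ∧ ∀ x ∉ L z, w z x = 0) ∧
      ∀ x ∈ t ⁻¹' O, ∑ z ∈ s, w z x = ρ x := by
  obtain ⟨s, m, n, σ, b, L, hb, hpos⟩ := exists_bumps t hK
  have hB : CkOn (⊤ : ℕ∞) (fun x => ∑ z ∈ s, b z x) Set.univ := CkOn.sum fun z _ => (hb z).1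
  have hBo : IsOpen {x | ∑ z ∈ s, b z x ≠ 0} :=
    isOpen_ne_fun (continuousOn_univ.1 (hB.continuousOn isOpen_univ)) continuous_const
  -- A partition of unity multiplied by `ρ`. Over `O` the denominator can vanish only off `tsupport
  -- ρ`, where the numerator is zero and division by zero does no harm; elsewhere smoothness is not
  -- claimed.
  refine ⟨s, m, n, σ, fun z x => ρ x * b z x / ∑ z ∈ s, b z x, L,
    fun z => ⟨?_, (hb z).2.1, (hb z).2.2.1, fun x hx => ?_⟩, fun x hx => ?_⟩
  · refine CkOn.of_locally fun x hx => ?_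
    by_cases hxρ : x ∈ tsupport ρ
    · exact ⟨_, hBo, (hpos x ⟨hxρ, hOK hx⟩).ne', CkOn.div
        ((hρ.mul (hb z).1).mono (Set.subset_univ _)) (hB.mono (Set.subset_univ _)) fun _ h => h⟩
    · refine ⟨(tsupport ρ)ᶜ, (isClosed_tsupport ρ).isOpen_compl, hxρ, (ckOn_const 0).congr ?_⟩
      intro x hx
      simp [image_eq_zero_of_notMem_tsupport hx]
  · simp [(hb z).2.2.2 x hx]
  · simp only
    rw [← Finset.sum_div, ← Finset.mul_sum]
    by_cases hxρ : x ∈ tsupport ρ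
    · exact mul_div_cancel_right₀ _ (hpos x ⟨hxρ, hOK hx⟩).ne'
    · simp [image_eq_zero_of_notMem_tsupport hxρ]

end Weights

/-! ### Linearity of the integral in a finite dimensional vector space. -/

section VectorIntegral

variable {𝕂 : Type} [RCLike 𝕂] {α : Type*} [MeasurableSpace α] {V : Type*} [AddCommGroup V]
  [Module 𝕂 V] [FiniteDimensional 𝕂 V] {g g' : α → V} {μ : Measure α}

theorem vectorIntegral_add (hg : ComponentwiseIntegrable 𝕂 g μ)
    (hg' : ComponentwiseIntegrable 𝕂 g' μ) :
    vectorIntegral 𝕂 (fun a => g a + g' a) μ = vectorIntegral 𝕂 g μ + vectorIntegral 𝕂 g' μ := by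
  simp only [vectorIntegral, map_add, ← Finset.sum_add_distrib, ← add_smul]
  refine Finset.sum_congr rfl fun j _ => ?_
  rw [integral_add (hg _) (hg' _)]

theorem vectorIntegral_smul (c : 𝕂) :
    vectorIntegral 𝕂 (fun a => c • g a) μ = c • vectorIntegral 𝕂 g μ := by
  simp only [vectorIntegral, map_smul, Finset.smul_sum, smul_smul, smul_eq_mul]
  refine Finset.sum_congr rfl fun j _ => ?_
  rw [integral_const_mul]

/-- The passage from the integral defined by a basis, in a space without topology, to a Bochner
integral in `𝕂ʳ`. -/
theorem map_vectorIntegral_pi {r : ℕ} (hg : ComponentwiseIntegrable 𝕂 g μ)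
    (T : V →ₗ[𝕂] (Fin r → 𝕂)) : T (vectorIntegral 𝕂 g μ) = ∫ a, T (g a) ∂μ := by
  funext j
  rw [eval_integral (f := fun a => T (g a)) fun j => hg ((LinearMap.proj j).comp T)]
  exact map_vectorIntegral 𝕂 hg ((LinearMap.proj j).comp T)

end VectorIntegral

/-! ### Continuity and integrability along a single fiber. -/

section FiberContinuity

variable {P Z Y : Type*} [TopologicalSpace P] [TopologicalSpace Z] [TopologicalSpace Y]
  [DiffManifold P] [DiffManifold Z] [DiffManifold Y] {f : DiffMap P Y} {t : Submersion Z Y}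
  {𝕂 : Type} [RCLike 𝕂] {E : P → Type*} [∀ y, AddCommGroup (E y)]
  [∀ y, Module 𝕂 (E y)] [DiffVectorBundle 𝕂 E] {k : ℕ∞}

theorem continuous_coord_fiber {τ : LocalTriv 𝕂 E} (hτ : τ.IsSmooth) {y : P} (hy : y ∈ τ.baseSet)
    (θ : CkSection 𝕂 k (Pullback (FiberProd.proj f t) E)) :
    Continuous fun z : {z : Z // t z = f y} => τ.coord y (θ (FiberProd.mk y z.1 z.2.symm)) := by
  have h := (θ.2 _ (hτ.pullback (FiberProd.proj f t))).continuousOn (LocalTriv.isOpen_baseSet _)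
  exact h.comp_continuous (f := fun z : {z : Z // t z = f y} => FiberProd.mk y z.1 z.2.symm)
    (Continuous.subtype_mk (continuous_const.prodMk continuous_subtype_val) _) fun _ => hy

theorem isCompact_preimage_fiber [T2Space Y] (t : Submersion Z Y) (x : Y) {L : Set Z}
    (hL : IsCompact (L ∩ t ⁻¹' {x})) : IsCompact {z : {z : Z // t z = x} | z.1 ∈ L} := by
  have hc : IsClosed {z : Z | t z = x} := isClosed_eq t.continuous_toFun continuous_const
  have h := hc.isClosedEmbedding_subtypeVal.isCompact_preimage hL
  have e : {z : {z : Z // t z = x} | z.1 ∈ L} = Subtype.val ⁻¹' (L ∩ t ⁻¹' {x}) :=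
    Set.ext fun z => ⟨fun hz => ⟨hz, z.2⟩, fun hz => hz.1⟩
  rw [e]
  exact h

/-- Along the closed fiber the integrand is continuous with compact support. Compactness is asked
only of `L ∩ t⁻¹(x)`, so that `L` may be the whole support of `κ ∘ s`. -/
theorem integrable_smul_fiber [T2Space Z] [T2Space Y] [MeasurableSpace Z] [BorelSpace Z] {x : Y}
    {μ : Measure {z : Z // t z = x}} [IsFiniteMeasureOnCompacts μ] {w : Z → ℝ} {O : Set Y}
    (hx : x ∈ O) (hw : ContinuousOn w (t ⁻¹' O)) {L : Set Z} (hL : IsCompact (L ∩ t ⁻¹' {x}))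
    (hw0 : ∀ z ∉ L, w z = 0) {W : Type*} [NormedAddCommGroup W] [NormedSpace ℝ W]
    {g : {z : Z // t z = x} → W} (hg : Continuous g) :
    Integrable (fun z => w z.1 • g z) μ := by
  have hwc : Continuous fun z : {z : Z // t z = x} => w z.1 :=
    hw.comp_continuous continuous_subtype_val fun z => by
      change t z.1 ∈ O
      rwa [z.2]
  refine (hwc.smul hg).integrable_of_hasCompactSupport
    (HasCompactSupport.intro (isCompact_preimage_fiber t x hL) fun z hz => ?_)
  simp [hw0 z.1 hz]

end FiberContinuity

/-! ### Integration against a normalized Haar system. -/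

namespace DiffGroupoid.NormalizedLeftHaarSystem

variable {Γ X P : Type*} [TopologicalSpace Γ] [TopologicalSpace X] [TopologicalSpace P]
  [DiffManifold Γ] [DiffManifold X] [DiffManifold P] [MeasurableSpace Γ] {G : DiffGroupoid Γ X} (ν : G.NormalizedLeftHaarSystem)
  {f : DiffMap P X} {𝕂 : Type} [RCLike 𝕂] {E : P → Type*} [∀ y, AddCommGroup (E y)]
  [∀ y, Module 𝕂 (E y)] [DiffVectorBundle 𝕂 E] {k : ℕ∞}

theorem ckOn_κ_src : CkOn (⊤ : ℕ∞) (fun h => ν.κ (G.src h)) Set.univ :=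
  ν.smooth_κ.comp_diffMap isOpen_univ G.src.toDiffMap

theorem continuous_κ_src : Continuous fun h => ν.κ (G.src h) :=
  continuousOn_univ.1 (ν.ckOn_κ_src.continuousOn isOpen_univ)

theorem measurable_ofReal_κ_src [BorelSpace Γ] (x : X) :
    Measurable fun h : G.TargetFiber x => ENNReal.ofReal (ν.κ (G.src h.1)) :=
  (ν.continuous_κ_src.comp continuous_subtype_val).measurable.ennreal_ofReal

theorem integral_fiberMeasure [BorelSpace Γ] {x : X} {W : Type*} [NormedAddCommGroup W] [NormedSpace ℝ W]
    (g : G.TargetFiber x → W) :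
    ∫ h, g h ∂ν.fiberMeasure x = ∫ h, ν.κ (G.src h.1) • g h ∂ν.measure x := by
  rw [fiberMeasure, integral_withDensity_eq_integral_toReal_smul (ν.measurable_ofReal_κ_src x)
    (by simp)]
  simp only [ENNReal.toReal_ofReal (ν.κ_nonneg _)]

variable [T2Space Γ] [T2Space X] [BorelSpace Γ]

theorem integrable_fiberMeasure {x : X} {W : Type*} [NormedAddCommGroup W] [NormedSpace ℝ W]
    {g : G.TargetFiber x → W} (hg : Continuous g) : Integrable g (ν.fiberMeasure x) := by
  have := ν.regular x
  rw [fiberMeasure, integrable_withDensity_iff_integrable_smul' (ν.measurable_ofReal_κ_src x)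
    (by simp)]
  simp only [ENNReal.toReal_ofReal (ν.κ_nonneg _)]
  exact integrable_smul_fiber (Set.mem_univ x) ν.continuous_κ_src.continuousOn
    (ν.properlySupported {x} isCompact_singleton)
    (fun z hz => image_eq_zero_of_notMem_tsupport (f := fun h => ν.κ (G.src h)) hz) hg

/-- The fiber `E y` carries no topology, so the functional is factored through a trivialization: on
`𝕂ʳ` it is continuous, and the coordinates of the section are continuous along the target fiber. -/
theorem componentwiseIntegrable (θ : CkSection 𝕂 k (Pullback (FiberProd.proj f G.tgt) E))
    (y : P) : ComponentwiseIntegrable 𝕂 (integrand f θ y) (ν.fiberMeasure (f y)) := by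
  intro l
  obtain ⟨τ, hτ, hy⟩ := DiffVectorBundle.exists_triv (𝕂 := 𝕂) (E := E) y
  let e := LinearEquiv.ofBijective (τ.coord y) (τ.bijective_coord y hy)
  have hl : Continuous (l ∘ₗ e.symm.toLinearMap) := LinearMap.continuous_of_finiteDimensional _
  have h := ν.integrable_fiberMeasure
    (hl.comp (continuous_coord_fiber (LocalTriv.isSmooth_of_mem_atlas hτ) hy θ))
  refine h.congr (Filter.Eventually.of_forall fun z => ?_)
  exact congrArg l (e.symm_apply_apply _)

/-- The coordinates of the section `∫ θ dν` in a local trivialization. -/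
theorem coord_integral (τ : LocalTriv 𝕂 E)
    (θ : CkSection 𝕂 k (Pullback (FiberProd.proj f G.tgt) E)) (y : P) :
    τ.coord y (ν.integral 𝕂 f θ y) =
      ∫ h : G.TargetFiber (f y),
        ν.κ (G.src h.1) • τ.coord y (θ (FiberProd.mk y h.1 h.2.symm)) ∂ν.measure (f y) := by
  have := DiffVectorBundle.finiteDimensional 𝕂 E y
  rw [integral, map_vectorIntegral_pi (ν.componentwiseIntegrable θ y), integral_fiberMeasure]
  rfl

/-- The local expression of `∫ θ dν` is of class `C^k`, and its derivatives are bounded over compact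
sets by the seminorms of `θ`. -/
theorem exists_local_bound {p : ℕ} {χ : OpenPartialHomeomorph P (Fin p → ℝ)}
    (hχ : IsSmoothChart χ) {τ : LocalTriv 𝕂 E} (hτ : τ.IsSmooth) {K : Set P} (hK : IsCompact K)
    (hKχ : K ⊆ χ.source) (hKτ : K ⊆ τ.baseSet) (r : ℕ) (hr : (r : ℕ∞) ≤ k) :
    ∃ (S : Finset (CkSeminormIndex 𝕂 k (Pullback (FiberProd.proj f G.tgt) E))) (C : ℝ), 0 ≤ C ∧
      ∀ θ : CkSection 𝕂 k (Pullback (FiberProd.proj f G.tgt) E), ∀ y ∈ K,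
        ContDiffAt ℝ k (fun a => τ.coord (χ.symm a) (ν.integral 𝕂 f θ (χ.symm a))) (χ y) ∧
        ∀ s ≤ r, ‖iteratedFDeriv ℝ s
            (fun a => τ.coord (χ.symm a) (ν.integral 𝕂 f θ (χ.symm a))) (χ y)‖ ≤
          C * (S.sup (ckSeminormFamily 𝕂 k _)) θ := by
  classical
  -- A point of `K`, paired with a unit arrow, supplies the default point `q₀` that `fiberChart`
  -- requires.
  rcases K.eq_empty_or_nonempty with rfl | ⟨y₀, -⟩
  · exact ⟨∅, 0, le_rfl, fun _ _ h => absurd h (Set.notMem_empty _)⟩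
  have := weaklyLocallyCompactSpace (M := X)
  obtain ⟨K', hK', hKK'⟩ := exists_compact_superset (hK.image f.continuous_toFun)
  have hO : IsOpen (interior K') := isOpen_interior
  obtain ⟨s, m, n, σ, w, L, hw, hsum⟩ := exists_weights G.tgt ν.ckOn_κ_src interior_subset
    (ν.properlySupported K' hK')
  obtain ⟨δ, hδ⟩ := ν.differentiable
  let q₀ : FiberProd f G.tgt := FiberProd.mk y₀ (G.one (f y₀)) (G.tgt_one _).symm
  set U := integralDomain χ τ f (interior K') with hU
  have hUo : IsOpen U := isOpen_integralDomain hO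
  have hA : IsCompact (χ '' K) := hK.image_of_continuousOn (χ.continuousOn.mono hKχ)
  have hAU : χ '' K ⊆ U := by
    rintro _ ⟨y, hy, rfl⟩
    refine ⟨χ.map_source (hKχ hy), ?_⟩
    rw [Set.mem_preimage, χ.left_inv (hKχ hy)]
    exact ⟨hKτ hy, hKK' ⟨y, hy, rfl⟩⟩
  choose i C hC0 hC using fun z => exists_norm_iteratedFDeriv_localIntegrand_le (σ := σ z)
    (q₀ := q₀) (δ := δ) hχ hτ hO (hw z).1 (hw z).2.1 (hw z).2.2.1 (hw z).2.2.2 hA hAU r hr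
  set V : ∀ z, Set (Fin (m z) → ℝ) := fun z => (fun x => ((σ z).chart x).1) '' L z with hV
  have hVc : ∀ z, IsCompact (V z) := fun z => isCompact_verticalImage (hw z).2.1 (hw z).2.2.1
  -- Each chart contributes its own seminorm and its integrand bound times the volume of its
  -- vertical support; all are independent of `θ`.
  refine ⟨s.image i, ∑ z ∈ s, C z * volume.real (V z),
    Finset.sum_nonneg fun z _ => mul_nonneg (hC0 z) measureReal_nonneg, fun θ y hy => ?_⟩
  set F := fun z => localIntegrand χ (σ z) q₀ δ (w z) τ θ with hF
  have hFc : ∀ z, ContDiffOn ℝ k (F z) (U ×ˢ Set.univ) := fun z =>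
    contDiffOn_localIntegrand hχ hτ hO (hw z).1 (hw z).2.1 (hw z).2.2.1 (hw z).2.2.2 θ
  have hF0 : ∀ z, ∀ a ∈ U, ∀ v ∉ V z, F z (a, v) = 0 := fun z a _ v hv =>
    localIntegrand_eq_zero_of_notMem_image (hw z).2.2.2 _ hv
  have hformula : ∀ a ∈ U, τ.coord (χ.symm a) (ν.integral 𝕂 f θ (χ.symm a)) =
      ∑ z ∈ s, ∫ v, F z (a, v) := by
    intro a ha
    have := ν.regular (f (χ.symm a))
    have hint : ∀ z, Integrable (fun h : G.TargetFiber (f (χ.symm a)) =>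
        w z h.1 • τ.coord (χ.symm a) (θ (FiberProd.mk (χ.symm a) h.1 h.2.symm)))
        (ν.measure (f (χ.symm a))) := fun z =>
      integrable_smul_fiber (t := G.tgt) (x := f (χ.symm a)) (O := interior K') ha.2.2
        ((hw z).1.continuousOn (hO.preimage G.tgt.continuous_toFun))
        ((hw z).2.1.inter_right (isClosed_singleton.preimage G.tgt.continuous_toFun))
        (hw z).2.2.2 (continuous_coord_fiber hτ ha.2.1 θ)
    rw [coord_integral]
    calc _ = ∫ h : G.TargetFiber (f (χ.symm a)), ∑ z ∈ s,
          w z h.1 • τ.coord (χ.symm a) (θ (FiberProd.mk (χ.symm a) h.1 h.2.symm))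
          ∂ν.measure (f (χ.symm a)) := by
          refine integral_congr_ae (Filter.Eventually.of_forall fun h => ?_)
          simp only
          rw [← Finset.sum_smul, hsum h.1]
          change G.tgt h.1 ∈ interior K'
          rw [h.2]
          exact ha.2.2
      _ = _ := by
          rw [integral_finsetSum _ fun z _ => hint z]
          exact Finset.sum_congr rfl fun z _ => integral_fiber_eq_integral_localIntegrand ha.1
            (hδ _) (hw z).2.2.1 (hw z).2.2.2 _ (hint z).aestronglyMeasurable
  have hyU : χ y ∈ U := hAU ⟨y, hy, rfl⟩
  have hev : (fun a => τ.coord (χ.symm a) (ν.integral 𝕂 f θ (χ.symm a))) =ᶠ[𝓝 (χ y)]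
      fun a => ∑ z ∈ s, ∫ v, F z (a, v) := by
    filter_upwards [hUo.mem_nhds hyU] with a ha using hformula a ha
  have hcd : ∀ z, ContDiffAt ℝ k (fun a => ∫ v, F z (a, v)) (χ y) := fun z =>
    (contDiffOn_integral_of_compact hUo (hVc z) (hFc z) (hF0 z)).contDiffAt (hUo.mem_nhds hyU)
  refine ⟨(ContDiffAt.sum fun z _ => hcd z).congr_of_eventuallyEq hev, fun j hj => ?_⟩
  have hjk : ((j : ℕ) : WithTop ℕ∞) ≤ ((k : ℕ∞) : WithTop ℕ∞) := by
    exact_mod_cast (Nat.cast_le.2 hj).trans hr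
  rw [(hev.iteratedFDeriv ℝ j).eq_of_nhds,
    iteratedFDeriv_fun_sum_apply fun z _ => (hcd z).of_le hjk, Finset.sum_mul]
  refine norm_sum_le_of_le _ fun z hz => ?_
  refine (norm_iteratedFDeriv_integral_le hUo (hVc z) j ((hFc z).of_le hjk) (hF0 z) hyU
    fun v => hC z θ _ ⟨y, hy, rfl⟩ v j hj).trans ?_
  rw [mul_right_comm]
  refine mul_le_mul_of_nonneg_left ?_ (mul_nonneg (hC0 z) measureReal_nonneg)
  exact Seminorm.le_def.1 (Finset.le_sup (f := ckSeminormFamily 𝕂 k _)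
    (Finset.mem_image_of_mem i hz)) θ

/-- Only the regularity half of `exists_local_bound` is needed, so a one-point compact set and order
zero suffice. -/
theorem integral_mem_ckSections (θ : CkSection 𝕂 k (Pullback (FiberProd.proj f G.tgt) E)) :
    ν.integral 𝕂 f θ ∈ ckSections 𝕂 k E := by
  rintro τ hτ n φ hφ a ⟨ha, hb⟩
  obtain ⟨_, _, _, h⟩ := ν.exists_local_bound (f := f) (k := k) hφ hτ
    (isCompact_singleton (x := φ.symm a))
    (Set.singleton_subset_iff.2 (φ.map_target ha)) (Set.singleton_subset_iff.2 hb) 0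
    (by exact_mod_cast zero_le)
  have h1 := (h θ _ rfl).1
  rw [φ.right_inv ha] at h1
  exact h1.contDiffWithinAt

/-- The linear map `θ ↦ ∫ θ dν` between spaces of sections of class `C^k`. -/
noncomputable def integralLinearMap (f : DiffMap P X) :
    CkSection 𝕂 k (Pullback (FiberProd.proj f G.tgt) E) →ₗ[𝕂] CkSection 𝕂 k E where
  toFun θ := ⟨ν.integral 𝕂 f θ, ν.integral_mem_ckSections θ⟩
  map_add' θ η := by
    refine Subtype.ext (funext fun y => ?_)
    have := DiffVectorBundle.finiteDimensional 𝕂 E y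
    exact vectorIntegral_add (ν.componentwiseIntegrable θ y) (ν.componentwiseIntegrable η y)
  map_smul' c θ := by
    refine Subtype.ext (funext fun y => ?_)
    have := DiffVectorBundle.finiteDimensional 𝕂 E y
    exact vectorIntegral_smul c

/-- Both topologies are generated by seminorms, so it suffices to bound each target seminorm by a
multiple of a finite supremum of source seminorms, as `exists_local_bound` does. -/
theorem continuous_integralLinearMap (f : DiffMap P X) :
    Continuous (ν.integralLinearMap (𝕂 := 𝕂) (E := E) (k := k) f) := by
  refine WithSeminorms.continuous_of_isBounded (p := ckSeminormFamily 𝕂 k _)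
    (q := ckSeminormFamily 𝕂 k _) ⟨rfl⟩ ⟨rfl⟩ _ (Seminorm.IsBounded.of_real fun i => ?_)
  obtain ⟨S, C, hC, h⟩ := ν.exists_local_bound (f := f) (k := k) i.isSmoothChart i.isSmooth_triv
    i.isCompact_K i.K_subset_source i.K_subset_baseSet i.r i.r_le
  refine ⟨S, C, fun θ => ?_⟩
  -- Nonnegativity covers the empty compact set, where the real supremum is zero by convention.
  have h0 : 0 ≤ C * (S.sup (ckSeminormFamily 𝕂 k _)) θ := mul_nonneg hC (apply_nonneg _ _)
  refine Seminorm.finset_sup_apply_le h0 fun s _ => ?_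
  exact Real.iSup_le (fun x => (h θ x x.2).2 s (Nat.lt_succ_iff.1 s.2)) h0

end DiffGroupoid.NormalizedLeftHaarSystem

theorem mainTheorem7 {Γ : Type*} {X : Type*} {P : Type*}
    [TopologicalSpace Γ] [TopologicalSpace X] [TopologicalSpace P]
    [DiffManifold Γ] [DiffManifold X] [DiffManifold P]
    [T2Space Γ] [SecondCountableTopology Γ] [T2Space X] [SecondCountableTopology X]
    [MeasurableSpace Γ] [BorelSpace Γ]
    (G : DiffGroupoid Γ X) (ν : G.NormalizedLeftHaarSystem)
    (f : DiffMap P X)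
    (𝕂 : Type) [RCLike 𝕂] (E : P → Type*) [∀ y, AddCommGroup (E y)] [∀ y, Module 𝕂 (E y)]
    [DiffVectorBundle 𝕂 E] (k : ℕ∞) :
    (∀ (θ : CkSection 𝕂 k (Pullback (FiberProd.proj f G.tgt) E)) (y : P),
      ComponentwiseIntegrable 𝕂
        (DiffGroupoid.NormalizedLeftHaarSystem.integrand f θ y) (ν.fiberMeasure (f y))) ∧
    (∀ θ : CkSection 𝕂 k (Pullback (FiberProd.proj f G.tgt) E),
      ν.integral 𝕂 f θ ∈ ckSections 𝕂 k E) ∧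
    ∃ J : CkSection 𝕂 k (Pullback (FiberProd.proj f G.tgt) E) →L[𝕂] CkSection 𝕂 k E,
      ∀ θ y, J θ y = ν.integral 𝕂 f θ y := by
  exact ⟨ν.componentwiseIntegrable, ν.integral_mem_ckSections,
    ⟨ν.integralLinearMap f, ν.continuous_integralLinearMap f⟩, fun _ _ => rfl⟩
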